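/- There is a map $F:[0,1]^2\to[0,1]^2$ such that, for every integer $d\ge 2$, the direct product $T=F\times\mathrm{id}_{[0,1]^{d-2}}:[0,1]^d\to[0,1]^d$ (so $T=F$ for $d=2$) is continuous and piecewise affine, satisfies $$h_{\mathrm{top}}(T)=\sup_{\mu}h(T,\mu)=\log 2,$$ where $\mu$ ranges over the $T$-invariant Borel probability measures on $[0,1]^d$, and has no measure of maximal entropy, that is, no $T$-invariant Borel probability measure $\mu$ achieves this supremum. Here $T:[0,1]^d\to[0,1]^d$ is piecewise affine if $[0,1]^d$ has a finite partition such that the restriction of $T$ to each element of the partition is the restriction of an affine map $\mathbb{R}^d\to\mathbb{R}^d$; $h_{\mathrm{top}}(T)$ is the topological entropy of $T$, and $h(T,\mu)$ is the measure-theoretic (Kolmogorov–Sinai) entropy of $T$ with respect to $\mu$. In particular, for every integer $d\ge2$ there is a piecewise affine, globally continuous map of $[0,1]^d$ with these properties. -/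

import Mathlib

open MeasureTheory Filter

noncomputable section

namespace PiecewiseAffineEntropy

/-- The unit cube `[0,1]^d`, as a subspace of `ℝ^d`. -/
abbrev Cube (d : ℕ) : Type := ↥(Set.Icc (0 : Fin d → ℝ) 1)

/-- A self-map of `[0,1]^d` is piecewise affine if there is a finite partition of the cube on each
element of which the map is the restriction of an affine map of `ℝ^d`. -/
def IsPiecewiseAffine {d : ℕ} (T : Cube d → Cube d) : Prop :=
  ∃ P : Set (Set (Cube d)), P.Finite ∧ Setoid.IsPartition P ∧
    ∀ A ∈ P, ∃ L : (Fin d → ℝ) →ᵃ[ℝ] (Fin d → ℝ),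
      ∀ x ∈ A, (T x : Fin d → ℝ) = L (x : Fin d → ℝ)

/-- The topological entropy of a self-map of a compact space (Bowen's definition). -/
def topEntropy {X : Type*} [UniformSpace X] (T : X → X) : EReal :=
  Dynamics.coverEntropy T Set.univ

section MeasureEntropy

variable {X : Type*} [MeasurableSpace X]

/-- Shannon entropy `-∑ₐ μ(A_a) log μ(A_a)` of the finite partition of `X` into the level sets
`A_a = {x | f x = a}` of a map `f` with values in a finite type. -/
def partitionEntropy {α : Type*} [Fintype α] (μ : Measure X) (f : X → α) : ℝ :=
  ∑ a, Real.negMulLog (μ.real (f ⁻¹' {a}))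

/-- The coding map `x ↦ (ξ x, ξ (T x), …, ξ (T^{n-1} x))`; its level sets are the elements of the
joined partition `ξ ∨ T⁻¹ ξ ∨ ⋯ ∨ T^{-(n-1)} ξ`. -/
def itinerary {α : Type*} (T : X → X) (ξ : X → α) (n : ℕ) : X → (Fin n → α) :=
  fun x j ↦ ξ (T^[j] x)

/-- The entropy `h(T, μ, ξ) = lim (1/n) H_μ(ξ ∨ T⁻¹ ξ ∨ ⋯ ∨ T^{-(n-1)} ξ)` of `T` with respect to
a finite partition `ξ`. (The limit exists when `μ` is invariant, and equals this upper limit.) -/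
def entropyOfPartition {α : Type*} [Fintype α] (T : X → X) (μ : Measure X) (ξ : X → α) : EReal :=
  limsup (fun n : ℕ ↦ ((partitionEntropy μ (itinerary T ξ n) / n : ℝ) : EReal)) atTop

/-- The Kolmogorov–Sinai entropy `h(T, μ)`: the supremum of `h(T, μ, ξ)` over all finite measurable
partitions `ξ` of `X`, each given as the level sets of a measurable map `X → {0, …, k-1}`. -/
def measureEntropy (T : X → X) (μ : Measure X) : EReal :=
  ⨆ (k : ℕ) (ξ : X → Fin k) (_ : Measurable ξ), entropyOfPartition T μ ξ

/-- The set of `T`-invariant probability measures. -/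
def invariantProbabilities (T : X → X) : Set (Measure X) :=
  {μ | IsProbabilityMeasure μ ∧ MeasurePreserving T μ μ}

/-- The supremum of the entropies `h(T, μ)` over all `T`-invariant probability measures `μ`. -/
def supMeasureEntropy (T : X → X) : EReal :=
  ⨆ μ ∈ invariantProbabilities T, measureEntropy T μ

end MeasureEntropy

/-- The first two coordinates of a point of `[0,1]^d`, for `d ≥ 2`. -/
def planarPart {d : ℕ} (hd : 2 ≤ d) (x : Cube d) : Cube 2 :=
  ⟨fun i ↦ (x : Fin d → ℝ) (Fin.castLE hd i),
    fun i ↦ x.2.1 (Fin.castLE hd i), fun i ↦ x.2.2 (Fin.castLE hd i)⟩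

/-- `T` is the direct product of `F : [0,1]^2 → [0,1]^2` with the identity of `[0,1]^(d-2)`:
it acts as `F` on the first two coordinates and fixes all the others. -/
def IsProductWithId {d : ℕ} (hd : 2 ≤ d) (F : Cube 2 → Cube 2) (T : Cube d → Cube d) : Prop :=
  ∀ x : Cube d, planarPart hd (T x) = F (planarPart hd x) ∧
    ∀ i : Fin d, 2 ≤ (i : ℕ) → (T x : Fin d → ℝ) i = (x : Fin d → ℝ) i

end PiecewiseAffineEntropy

end

/-! The planar map sees `x` only through `m = min x y`, so it first retracts the square to the
triangle `x ≤ y`. There a point with `y > 0` is described by `y` and its slope `t = m / y`. If `t ≥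
1/2`, then `y` is halved and `t` becomes `2 (1 - t)`. If `t` is small, then `y` is doubled, capped
at `1`, and `t` is multiplied by a factor between `3` and `6`. The wedge left between these regimes
(the gap) is sent to the diagonal, then to the line `x = 0`, where the future is forced. Hence the
dynamics is a full two-shift of halvings and doublings, driving a walk on the scales `y = 2 ^ (-l)`
that is reflected at `l = 0`.

Upper bounds. The binary symbols, together with polynomially many values of extra data, determine an
orbit segment of length `n` up to `ε` (`hasSubexponentialCode_cubeMap`): ratios of second
coordinates are controlled forwards in time, slopes backwards in time, where the branches contract.
So the topological entropy is at most `log 2`, and the entropy of every invariant measure is at most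
`H_m / m` for each `m`, where `H_m` is the entropy of the words of `m` symbols.

No maximal measure. Entropy `log 2` would force `H_m = m log 2` for all `m`, so the symbols would be
independent fair coin tosses and the walk a simple random walk on `ℕ` reflected at `0`. This walk is
null recurrent: it leaves every bounded set of levels in probability. By invariance the measure
would live on `y = 0`, where only one symbol occurs, a contradiction
(`exists_partitionEntropy_itinerary_lt`).

Lower bounds. Words made of blocks with `m` halvings and `m` doublings keep the walk, started at
level `m`, between `0` and `2 m`. They give a horseshoe with `centralBinom m` branches in time `2
m`, carrying a Bernoulli measure. Its rate `log (centralBinom m) / (2 m)` tends to `log 2`. -/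

namespace PiecewiseAffineEntropy

/-! ### Shannon entropy of finite partitions -/

section Shannon

variable {X : Type*} [MeasurableSpace X] {μ : Measure X} [IsProbabilityMeasure μ]
variable {α β : Type*} [Fintype α]

theorem partitionEntropy_nonneg (f : X → α) : 0 ≤ partitionEntropy μ f :=
  Finset.sum_nonneg fun _ _ ↦ Real.negMulLog_nonneg measureReal_nonneg measureReal_le_one

variable [MeasurableSpace α] [MeasurableSingletonClass α]

theorem sum_measureReal_fiber {f : X → α} (hf : Measurable f) :
    ∑ a, μ.real (f ⁻¹' {a}) = 1 := by
  have h := sum_measureReal_preimage_singleton (μ := μ) (f := f) Finset.univ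
    (fun y _ ↦ hf (measurableSet_singleton y))
  simpa using h

theorem negMulLog_sum_le {ι : Type*} (s : Finset ι) (p : ι → ℝ) (hp : ∀ i ∈ s, 0 ≤ p i) :
    Real.negMulLog (∑ i ∈ s, p i) ≤ ∑ i ∈ s, Real.negMulLog (p i) := by
  rw [Real.negMulLog, neg_mul, Finset.sum_mul, ← Finset.sum_neg_distrib]
  refine Finset.sum_le_sum fun i hi ↦ ?_
  rcases (hp i hi).eq_or_lt with h | h
  · simp [← h]
  · have h1 : p i ≤ ∑ j ∈ s, p j := Finset.single_le_sum hp hi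
    have h2 := Real.log_le_log h h1
    simp only [Real.negMulLog]
    nlinarith

theorem measureReal_comp_fiber [DecidableEq β] {f : X → α} (hf : Measurable f) (φ : α → β)
    (b : β) : μ.real ((φ ∘ f) ⁻¹' {b}) = ∑ a with φ a = b, μ.real (f ⁻¹' {a}) := by
  rw [sum_measureReal_preimage_singleton (μ := μ) (f := f) _
    (fun y _ ↦ hf (measurableSet_singleton y))]
  congr 1
  ext x
  simp

variable [Fintype β]

theorem partitionEntropy_comp_le {f : X → α} (hf : Measurable f) (φ : α → β) :
    partitionEntropy μ (φ ∘ f) ≤ partitionEntropy μ f := by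
  classical
  unfold partitionEntropy
  calc ∑ b, Real.negMulLog (μ.real ((φ ∘ f) ⁻¹' {b}))
      ≤ ∑ b, ∑ a with φ a = b, Real.negMulLog (μ.real (f ⁻¹' {a})) := by
        refine Finset.sum_le_sum fun b _ ↦ ?_
        rw [measureReal_comp_fiber hf]
        exact negMulLog_sum_le _ _ fun i _ ↦ measureReal_nonneg
    _ = ∑ a, Real.negMulLog (μ.real (f ⁻¹' {a})) :=
        Finset.sum_fiberwise _ _ _

/-- This is `log u ≤ u - 1` at `u = p q / r`, multiplied by `r`. When `r` is a joint law with
marginals `p` and `q`, the errors `p q - r` sum to zero, which gives subadditivity of entropy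
without conditional entropies. -/
theorem negMulLog_le_gibbs {r p q : ℝ} (hr : 0 ≤ r) (hrp : r ≤ p) (hrq : r ≤ q) :
    Real.negMulLog r ≤ -(r * Real.log p) - r * Real.log q + (p * q - r) := by
  rcases hr.eq_or_lt with h | h
  · subst h; simp; positivity
  · have hp : 0 < p := h.trans_le hrp
    have hq : 0 < q := h.trans_le hrq
    have h1 := Real.log_le_sub_one_of_pos (x := p * q / r) (by positivity)
    rw [Real.log_div (by positivity) h.ne', Real.log_mul hp.ne' hq.ne'] at h1
    have h2 : r * (p * q / r - 1) = p * q - r := by field_simp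
    have h3 := mul_le_mul_of_nonneg_left h1 h.le
    rw [h2] at h3
    simp only [Real.negMulLog]
    linarith

variable [MeasurableSpace β] [MeasurableSingletonClass β]

theorem partitionEntropy_prod_le {f : X → α} {g : X → β} (hf : Measurable f)
    (hg : Measurable g) :
    partitionEntropy μ (fun x ↦ (f x, g x)) ≤ partitionEntropy μ f + partitionEntropy μ g := by
  classical
  have hfg : Measurable fun x ↦ (f x, g x) := hf.prodMk hg
  set r : α → β → ℝ := fun a b ↦ μ.real ((fun x ↦ (f x, g x)) ⁻¹' {(a, b)}) with hr
  set p : α → ℝ := fun a ↦ μ.real (f ⁻¹' {a}) with hp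
  set q : β → ℝ := fun b ↦ μ.real (g ⁻¹' {b}) with hq
  have hpr : ∀ a, p a = ∑ b, r a b := by
    intro a
    have := measureReal_comp_fiber (μ := μ) hfg Prod.fst a
    change μ.real (f ⁻¹' {a}) = _ at this
    rw [hp]; simp only; rw [this]
    simp only [hr]
    rw [Finset.sum_filter, Fintype.sum_prod_type, Finset.sum_eq_single a]
    · simp
    · intro b _ hb; simp [hb]
    · simp
  have hqr : ∀ b, q b = ∑ a, r a b := by
    intro b
    have := measureReal_comp_fiber (μ := μ) hfg Prod.snd b
    change μ.real (g ⁻¹' {b}) = _ at this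
    rw [hq]; simp only; rw [this]
    simp only [hr]
    rw [Finset.sum_filter, Fintype.sum_prod_type]
    refine Finset.sum_congr rfl fun a _ ↦ ?_
    rw [Finset.sum_eq_single b]
    · simp
    · intro c _ hc; simp [hc]
    · simp
  have hr0 : ∀ a b, 0 ≤ r a b := fun a b ↦ measureReal_nonneg
  have hsp : ∑ a, p a = 1 := sum_measureReal_fiber hf
  have hsq : ∑ b, q b = 1 := sum_measureReal_fiber hg
  have key : ∑ a, ∑ b, Real.negMulLog (r a b) ≤
      ∑ a, ∑ b, (-(r a b * Real.log (p a)) - r a b * Real.log (q b) + (p a * q b - r a b)) :=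
    Finset.sum_le_sum fun a _ ↦ Finset.sum_le_sum fun b _ ↦
      negMulLog_le_gibbs (hr0 a b)
        (hpr a ▸ Finset.single_le_sum (fun i _ ↦ hr0 a i) (Finset.mem_univ b))
        (hqr b ▸ Finset.single_le_sum (f := fun a ↦ r a b) (fun i _ ↦ hr0 i b)
          (Finset.mem_univ a))
  have e1 : ∑ a, ∑ b, r a b * Real.log (p a) = -partitionEntropy μ f := by
    simp only [← Finset.sum_mul, ← hpr]
    simp [partitionEntropy, Real.negMulLog, hp]
  have e2 : ∑ a, ∑ b, r a b * Real.log (q b) = -partitionEntropy μ g := by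
    rw [Finset.sum_comm]
    simp only [← Finset.sum_mul, ← hqr]
    simp [partitionEntropy, Real.negMulLog, hq]
  have e3 : ∑ a, ∑ b, (p a * q b - r a b) = 0 := by
    simp only [Finset.sum_sub_distrib, ← Finset.mul_sum, ← hpr, hsq, mul_one, sub_self,
      Finset.sum_const_zero]
  have e4 : partitionEntropy μ (fun x ↦ (f x, g x)) = ∑ a, ∑ b, Real.negMulLog (r a b) := by
    unfold partitionEntropy
    rw [Fintype.sum_prod_type]
  rw [e4]
  refine key.trans_eq ?_
  simp only [Finset.sum_add_distrib, e3]
  simp only [Finset.sum_sub_distrib, Finset.sum_neg_distrib, e1, e2]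
  ring

theorem partitionEntropy_le_log_card [Nonempty α] {f : X → α} (hf : Measurable f) :
    partitionEntropy μ f ≤ Real.log (Fintype.card α) := by
  have hN : (0 : ℝ) < Fintype.card α := by exact_mod_cast Fintype.card_pos
  have h : ∀ a, Real.negMulLog (μ.real (f ⁻¹' {a})) ≤
      μ.real (f ⁻¹' {a}) * Real.log (Fintype.card α)
        + ((Fintype.card α : ℝ)⁻¹ - μ.real (f ⁻¹' {a})) := by
    intro a
    rcases (measureReal_nonneg (μ := μ) (s := f ⁻¹' {a})).eq_or_lt with h | h
    · simp [← h]
    · set p := μ.real (f ⁻¹' {a})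
      have h1 := Real.log_le_sub_one_of_pos (x := (p * Fintype.card α)⁻¹) (by positivity)
      rw [Real.log_inv, Real.log_mul h.ne' hN.ne'] at h1
      have h3 := mul_le_mul_of_nonneg_left h1 h.le
      have h2 : p * ((p * Fintype.card α)⁻¹ - 1) = (Fintype.card α : ℝ)⁻¹ - p := by field_simp
      rw [h2] at h3
      simp only [Real.negMulLog]
      linarith
  refine (Finset.sum_le_sum fun a _ ↦ h a).trans_eq ?_
  rw [Finset.sum_add_distrib, ← Finset.sum_mul, Finset.sum_sub_distrib,
    sum_measureReal_fiber hf]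
  simp

/-- The equality case of Jensen's inequality for the strictly concave function `-t log t`. It turns
maximal entropy into equidistribution of the words. -/
theorem measureReal_fiber_eq_of_log_card_le [Nonempty α] {f : X → α} (hf : Measurable f)
    (h : Real.log (Fintype.card α) ≤ partitionEntropy μ f) (a : α) :
    μ.real (f ⁻¹' {a}) = (Fintype.card α : ℝ)⁻¹ := by
  have hN : (0 : ℝ) < Fintype.card α := by exact_mod_cast Fintype.card_pos
  set p : α → ℝ := fun a ↦ μ.real (f ⁻¹' {a}) with hp
  have hsp : ∑ a, p a = 1 := sum_measureReal_fiber hf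
  by_contra hne
  have hlt := Real.strictConcaveOn_negMulLog.lt_map_sum (t := Finset.univ)
    (w := fun _ : α ↦ (Fintype.card α : ℝ)⁻¹) (p := p) (fun _ _ ↦ by positivity)
    (by simp) (fun i _ ↦ measureReal_nonneg)
    (by
      by_contra! hall
      apply hne
      have hc : ∀ b, p b = p a := fun b ↦ hall b (Finset.mem_univ _) a (Finset.mem_univ _)
      have : ∑ b : α, p b = Fintype.card α * p a := by simp [hc]
      rw [hsp] at this
      change p a = _
      field_simp; linarith)
  simp only [smul_eq_mul, ← Finset.mul_sum, hsp, mul_one] at hlt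
  rw [Real.negMulLog, Real.log_inv] at hlt
  have h2 : ∑ a, Real.negMulLog (p a) = partitionEntropy μ f := rfl
  rw [h2] at hlt
  have h3 := (mul_lt_mul_iff_right₀ (inv_pos.mpr hN)).mp
    (hlt.trans_eq (by ring : _ = (Fintype.card α : ℝ)⁻¹ * Real.log (Fintype.card α)))
  linarith

theorem neg_log_le_partitionEntropy {f : X → α} (hf : Measurable f) {q : ℝ}
    (h : ∀ a, μ.real (f ⁻¹' {a}) ≤ q) : -Real.log q ≤ partitionEntropy μ f := by
  calc -Real.log q = ∑ a, μ.real (f ⁻¹' {a}) * -Real.log q := by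
        rw [← Finset.sum_mul, sum_measureReal_fiber hf, one_mul]
    _ ≤ partitionEntropy μ f := by
        refine Finset.sum_le_sum fun a _ ↦ ?_
        rcases (measureReal_nonneg (μ := μ) (s := f ⁻¹' {a})).eq_or_lt with h0 | h0
        · simp [← h0]
        · rw [Real.negMulLog, neg_mul, mul_neg, neg_le_neg_iff]
          exact mul_le_mul_of_nonneg_left (Real.log_le_log h0 (h a)) h0.le

theorem partitionEntropy_pi_le {f : ℕ → X → β} (hf : ∀ j, Measurable (f j)) (n : ℕ) :
    partitionEntropy μ (fun x (j : Fin n) ↦ f j x)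
      ≤ ∑ j ∈ Finset.range n, partitionEntropy μ (f j) := by
  classical
  induction n with
  | zero =>
    have : Measurable fun x (j : Fin 0) ↦ f j x := measurable_pi_lambda _ fun j ↦ hf j
    simpa using partitionEntropy_le_log_card (μ := μ) this
  | succ n ih =>
    have h1 : Measurable fun x (j : Fin n) ↦ f j x := measurable_pi_lambda _ fun j ↦ hf j
    have h2 := partitionEntropy_comp_le (μ := μ) (h1.prodMk (hf n))
      (fun p : (Fin n → β) × β ↦ (Fin.snoc p.1 p.2 : Fin (n + 1) → β))
    have h3 : (fun p : (Fin n → β) × β ↦ (Fin.snoc p.1 p.2 : Fin (n + 1) → β)) ∘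
        (fun x ↦ ((fun j : Fin n ↦ f j x), f n x)) = fun x (j : Fin (n + 1)) ↦ f j x := by
      funext x j
      refine Fin.lastCases ?_ (fun i ↦ ?_) j
      · simp
      · simp
    rw [h3] at h2
    rw [Finset.sum_range_succ]
    exact h2.trans ((partitionEntropy_prod_le h1 (hf n)).trans (by gcongr))

end Shannon

/-- The function `-t log t` is continuous and vanishes at `0` and at `1`. The value `0` will mean
"no correction needed", so rare corrections cost little entropy, uniformly in the measure. -/
theorem exists_partitionEntropy_fin_succ_le (k : ℕ) {ε : ℝ} (hε : 0 < ε) :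
    ∃ δ > 0, ∀ {X : Type*} [MeasurableSpace X] (μ : Measure X) [IsProbabilityMeasure μ]
      (e : X → Fin (k + 1)), Measurable e → μ.real {x | e x ≠ 0} ≤ δ →
      partitionEntropy μ e ≤ ε := by
  set K : ℝ := (k : ℝ) with hK
  have hK0 : 0 ≤ K := by positivity
  have c0 : Tendsto Real.negMulLog (nhds 0) (nhds 0) := by
    simpa using Real.continuous_negMulLog.tendsto 0
  have c1 : Tendsto Real.negMulLog (nhds 1) (nhds 0) := by
    simpa using Real.continuous_negMulLog.tendsto 1
  have hη : 0 < ε / (K + 1) := by positivity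
  obtain ⟨δ0, hδ0, h0⟩ := Metric.tendsto_nhds_nhds.mp c0 _ hη
  obtain ⟨δ1, hδ1, h1⟩ := Metric.tendsto_nhds_nhds.mp c1 _ hη
  refine ⟨min δ0 δ1 / 2, by positivity, ?_⟩
  intro X _ μ _ e he hδ
  have hm := lt_min hδ0 hδ1
  have hm0 := min_le_left δ0 δ1
  have hm1 := min_le_right δ0 δ1
  unfold partitionEntropy
  rw [Fin.sum_univ_succ]
  have hnone : Real.negMulLog (μ.real (e ⁻¹' {0})) ≤ ε / (K + 1) := by
    have hc : μ.real (e ⁻¹' {0}) = 1 - μ.real {x | e x ≠ 0} := by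
      have : {x | e x ≠ 0} = (e ⁻¹' {0})ᶜ := by ext x; simp
      rw [this, probReal_compl_eq_one_sub (he (measurableSet_singleton _))]
      ring
    have := h1 (x := μ.real (e ⁻¹' {0})) (by
      have : 0 ≤ μ.real {x | e x ≠ 0} := measureReal_nonneg
      rw [hc, Real.dist_eq, abs_lt]; constructor <;> linarith)
    rw [Real.dist_eq, sub_zero] at this
    exact (le_abs_self _).trans this.le
  have hsome : ∀ a : Fin k, Real.negMulLog (μ.real (e ⁻¹' {a.succ})) ≤ ε / (K + 1) := by
    intro a
    have hle : μ.real (e ⁻¹' {a.succ}) ≤ μ.real {x | e x ≠ 0} := by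
      refine measureReal_mono fun x hx ↦ ?_
      simp only [Set.mem_preimage, Set.mem_singleton_iff] at hx
      simp [hx, Fin.succ_ne_zero]
    have := h0 (x := μ.real (e ⁻¹' {a.succ})) (by
      have : 0 ≤ μ.real (e ⁻¹' {a.succ}) := measureReal_nonneg
      rw [Real.dist_eq, abs_lt]; constructor <;> linarith)
    rw [Real.dist_eq, sub_zero] at this
    exact (le_abs_self _).trans this.le
  calc _ ≤ ε / (K + 1) + ∑ _a : Fin k, ε / (K + 1) :=
        add_le_add hnone (Finset.sum_le_sum fun a _ ↦ hsome a)
    _ = ε := by simp [← hK]; field_simp; ring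

/-! ### Subexponential codes and topological entropy -/

section Code

variable {X : Type*} {α : Type*}

theorem itinerary_eq_iff {T : X → X} {P : X → α} {n : ℕ} {x y : X} :
    itinerary T P n x = itinerary T P n y ↔ ∀ j < n, P (T^[j] x) = P (T^[j] y) := by
  simp only [funext_iff, itinerary]
  exact ⟨fun h j hj ↦ h ⟨j, hj⟩, fun h j ↦ h j j.2⟩

/-- The orbit segments of length `n` are determined, up to any prescribed precision, by their
`P`-itineraries together with a subexponential amount of measurable additional information. -/
def HasSubexponentialCode [PseudoMetricSpace X] [MeasurableSpace X] (T : X → X) (P : X → α) :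
    Prop :=
  ∀ ε > 0, ∃ N : ℕ → ℕ, Tendsto (fun n : ℕ ↦ Real.log (N n) / n) atTop (nhds 0) ∧
    ∀ n, ∃ c : X → Fin (N n), Measurable c ∧ ∀ x y,
      itinerary T P n x = itinerary T P n y → c x = c y → ∀ j < n, dist (T^[j] x) (T^[j] y) < ε

theorem measurable_itinerary [MeasurableSpace X] [MeasurableSpace α] {T : X → X} {P : X → α}
    (hT : Measurable T) (hP : Measurable P) (n : ℕ) : Measurable (itinerary T P n) :=
  measurable_pi_lambda _ fun j ↦ hP.comp (hT.iterate j)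

/-- One representative for each value taken by the code already forms a dynamical cover. -/
theorem coverMincard_le_of_code [PseudoMetricSpace X] {T : X → X} {β : Type*} [Fintype β]
    {U : SetRel X X} {ε : ℝ} (hU : ∀ x y, dist x y < ε → (x, y) ∈ U) (n : ℕ) (c : X → β)
    (hc : ∀ x y, c x = c y → ∀ j < n, dist (T^[j] x) (T^[j] y) < ε) :
    Dynamics.coverMincard T Set.univ U n ≤ Fintype.card β := by
  classical
  have hex : ∀ b : Set.range c, ∃ x, c x = b := fun b ↦ b.2
  choose g hg using hex
  set s : Finset X := Finset.univ.image g
  have hs : Dynamics.IsDynCoverOf T Set.univ U n (s : Set X) := by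
    intro x _
    refine ⟨g ⟨c x, x, rfl⟩, by simp [s], ?_⟩
    rw [Dynamics.mem_dynEntourage]
    exact fun k hk ↦ hU _ _ (hc _ _ (hg ⟨c x, x, rfl⟩).symm k hk)
  refine hs.coverMincard_le_card.trans ?_
  have : s.card ≤ Fintype.card β :=
    Finset.card_image_le.trans ((Finset.card_univ).trans_le (Fintype.card_subtype_le _))
  exact_mod_cast this

theorem ennrealLog_natCast {N : ℕ} (hN : 0 < N) :
    ENNReal.log (N : ENNReal) = ((Real.log N : ℝ) : EReal) := by
  rw [ENNReal.log_pos_real (by exact_mod_cast hN.ne') (ENNReal.natCast_ne_top N)]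
  simp

theorem coverEntropy_le_of_hasSubexponentialCode [PseudoMetricSpace X] [MeasurableSpace X]
    [Nonempty X] [Fintype α] [Nonempty α] {T : X → X} {P : X → α}
    (h : HasSubexponentialCode T P) :
    Dynamics.coverEntropy T Set.univ ≤ ((Real.log (Fintype.card α) : ℝ) : EReal) := by
  refine iSup₂_le fun U hU ↦ ?_
  obtain ⟨ε, hε, hεU⟩ := Metric.mem_uniformity_dist.mp hU
  obtain ⟨N, hN, hc⟩ := h ε hε
  have hNpos : ∀ n, 0 < N n := fun n ↦ by
    obtain ⟨c, -⟩ := hc n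
    exact (c (Classical.arbitrary X)).pos
  have ha : 0 < Fintype.card α := Fintype.card_pos
  have hbound : ∀ n, Dynamics.coverMincard T Set.univ U n
      ≤ ((Fintype.card α ^ n * N n : ℕ) : ℕ∞) := by
    intro n
    obtain ⟨c, -, hcc⟩ := hc n
    have := coverMincard_le_of_code (T := T) (fun x y hxy ↦ hεU hxy) n
      (fun x ↦ (itinerary T P n x, c x))
      (fun x y hxy ↦ hcc x y (Prod.ext_iff.mp hxy).1 (Prod.ext_iff.mp hxy).2)
    simpa using this
  have hlim : Tendsto (fun n : ℕ ↦
      (((Real.log (Fintype.card α) + Real.log (N n) / n : ℝ)) : EReal)) atTop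
      (nhds ((Real.log (Fintype.card α) : ℝ) : EReal)) := by
    refine (continuous_coe_real_ereal.tendsto _).comp ?_
    simpa using hN.const_add (Real.log (Fintype.card α))
  rw [← hlim.limsup_eq]
  refine limsup_le_limsup ?_
  filter_upwards [eventually_ge_atTop 1] with n hn
  have hn' : (0 : ℝ) < n := by exact_mod_cast hn
  have hpos : 0 < Fintype.card α ^ n * N n := Nat.mul_pos (Nat.pow_pos ha) (hNpos n)
  have h1 : ENNReal.log ((Dynamics.coverMincard T Set.univ U n : ENNReal)) ≤
      ((Real.log ((Fintype.card α ^ n * N n : ℕ) : ℝ) : ℝ) : EReal) := by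
    rw [← ennrealLog_natCast hpos]
    refine ENNReal.log_monotone ?_
    have := ENat.toENNReal_mono (hbound n)
    simpa using this
  refine (EReal.div_le_div_right_of_nonneg (by positivity) h1).trans ?_
  have h2 : ((n : ℕ) : EReal) = ((n : ℝ) : EReal) := by simp
  rw [h2, ← EReal.coe_div, EReal.coe_le_coe_iff]
  push_cast
  rw [Real.log_mul (by positivity) (by exact_mod_cast (hNpos n).ne'), Real.log_pow]
  apply le_of_eq
  field_simp

end Code

/-! ### Entropy of invariant measures in terms of a code -/

section Invariant

variable {X : Type*} [MeasurableSpace X] {μ : Measure X} [IsProbabilityMeasure μ]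
  {α : Type*} [Fintype α] [Nonempty α] [MeasurableSpace α] [MeasurableSingletonClass α]
  {T : X → X} {P : X → α}

omit [IsProbabilityMeasure μ] in
theorem partitionEntropy_comp_measurePreserving {β : Type*} [Fintype β] [MeasurableSpace β]
    [MeasurableSingletonClass β] {S : X → X} (hS : MeasurePreserving S μ μ) {f : X → β}
    (hf : Measurable f) : partitionEntropy μ (f ∘ S) = partitionEntropy μ f := by
  unfold partitionEntropy
  refine Finset.sum_congr rfl fun b _ ↦ ?_
  rw [Set.preimage_comp, hS.measureReal_preimage
    (hf (measurableSet_singleton b)).nullMeasurableSet]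

omit [Nonempty α] in
theorem partitionEntropy_itinerary_add_le (hT : MeasurePreserving T μ μ) (hP : Measurable P)
    (a b : ℕ) : partitionEntropy μ (itinerary T P (a + b)) ≤
      partitionEntropy μ (itinerary T P a) + partitionEntropy μ (itinerary T P b) := by
  have ha := measurable_itinerary hT.measurable hP a
  have hb := (measurable_itinerary hT.measurable hP b).comp (hT.measurable.iterate a)
  have h := partitionEntropy_comp_le (μ := μ) (ha.prodMk hb)
    (fun p : (Fin a → α) × (Fin b → α) ↦ Fin.append p.1 p.2)
  have h1 : (fun p : (Fin a → α) × (Fin b → α) ↦ Fin.append p.1 p.2) ∘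
      (fun x ↦ (itinerary T P a x, (itinerary T P b ∘ T^[a]) x)) = itinerary T P (a + b) := by
    funext x j
    refine Fin.addCases (fun i ↦ ?_) (fun i ↦ ?_) j
    · simp [itinerary]
    · simp [itinerary, ← Function.iterate_add_apply, add_comm]
  rw [h1] at h
  refine h.trans ((partitionEntropy_prod_le ha hb).trans_eq ?_)
  rw [partitionEntropy_comp_measurePreserving (hT.iterate a)
    (measurable_itinerary hT.measurable hP b)]

theorem partitionEntropy_itinerary_mul_le (hT : MeasurePreserving T μ μ) (hP : Measurable P)
    (m k : ℕ) : partitionEntropy μ (itinerary T P (m * k)) ≤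
      k * partitionEntropy μ (itinerary T P m) := by
  induction k with
  | zero =>
    simpa using partitionEntropy_le_log_card (μ := μ)
      (measurable_itinerary hT.measurable hP (m * 0))
  | succ k ih =>
    rw [mul_add, mul_one]
    refine (partitionEntropy_itinerary_add_le hT hP _ _).trans ?_
    push_cast
    linarith

/-- Subadditivity along the division `n = m (n / m) + n % m`; the remainder has fewer than `m`
letters, and its entropy is bounded trivially. This explicit form replaces the existence of the
limit. -/
theorem partitionEntropy_itinerary_div_le (hT : MeasurePreserving T μ μ) (hP : Measurable P)
    {m n : ℕ} (hm : 0 < m) (hn : 0 < n) : partitionEntropy μ (itinerary T P n) / n ≤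
      partitionEntropy μ (itinerary T P m) / m + m * Real.log (Fintype.card α) / n := by
  have hn' : (0 : ℝ) < n := by exact_mod_cast hn
  have hm' : (0 : ℝ) < m := by exact_mod_cast hm
  have hlog : 0 ≤ Real.log (Fintype.card α) := Real.log_natCast_nonneg _
  have h1 := partitionEntropy_itinerary_add_le hT hP (m * (n / m)) (n % m)
  rw [Nat.div_add_mod] at h1
  have h2 := partitionEntropy_itinerary_mul_le hT hP m (n / m)
  have h3 := partitionEntropy_le_log_card (μ := μ)
    (measurable_itinerary hT.measurable hP (n % m))
  have h4 : Real.log (Fintype.card (Fin (n % m) → α)) ≤ m * Real.log (Fintype.card α) := by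
    have : ((n % m : ℕ) : ℝ) ≤ m := by exact_mod_cast (Nat.mod_lt n hm).le
    simp only [Fintype.card_pi, Finset.prod_const, Finset.card_univ, Fintype.card_fin]
    push_cast
    rw [Real.log_pow]
    gcongr
  have h5 : ((n / m : ℕ) : ℝ) ≤ n / m := Nat.cast_div_le
  have h6 := mul_le_mul_of_nonneg_right h5
    (partitionEntropy_nonneg (μ := μ) (itinerary T P m))
  rw [div_add_div _ _ hm'.ne' hn'.ne', div_le_div_iff₀ hn' (by positivity)]
  have h7 : partitionEntropy μ (itinerary T P n) ≤
      n / m * partitionEntropy μ (itinerary T P m) + m * Real.log (Fintype.card α) := by linarith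
  calc partitionEntropy μ (itinerary T P n) * (m * n)
      ≤ (n / m * partitionEntropy μ (itinerary T P m) + m * Real.log (Fintype.card α))
        * (m * n) := by gcongr
    _ = _ := by field_simp

end Invariant

/-- Inner regularity gives a closed set inside each cell with almost all its mass. By compactness
these finitely many disjoint sets lie at positive distance from one another, and `K` is their union.
On `K`, knowing a point up to `ε` reveals its cell. -/
theorem exists_separated_closed_fibers {X : Type*} [PseudoMetricSpace X] [CompactSpace X]
    [MeasurableSpace X] [BorelSpace X] (μ : Measure X) [IsProbabilityMeasure μ] {k : ℕ}
    {ξ : X → Fin k} (hξ : Measurable ξ) {δ : ℝ} (hδ : 0 < δ) :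
    ∃ ε > 0, ∃ K : Set X, MeasurableSet K ∧ μ.real Kᶜ ≤ δ ∧
      ∀ x ∈ K, ∀ y ∈ K, dist x y < ε → ξ x = ξ y := by
  have hδ' : ENNReal.ofReal (δ / (k + 1)) ≠ 0 := by
    simp only [ne_eq, ENNReal.ofReal_eq_zero, not_le]; positivity
  have h1 : ∀ a : Fin k, ∃ F ⊆ ξ ⁻¹' {a}, IsClosed F ∧
      μ (ξ ⁻¹' {a} \ F) < ENNReal.ofReal (δ / (k + 1)) := fun a ↦
    (hξ (measurableSet_singleton a)).exists_isClosed_sdiff_lt (measure_ne_top _ _) hδ'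
  choose F hFsub hFclosed hFμ using h1
  have h2 : ∀ p : Fin k × Fin k, ∃ ε > 0, p.1 ≠ p.2 →
      ∀ x ∈ F p.1, ∀ y ∈ F p.2, ε ≤ dist x y := by
    rintro ⟨a, b⟩
    by_cases hab : a = b
    · exact ⟨1, one_pos, fun h ↦ (h hab).elim⟩
    · have hd : Disjoint (F a) (F b) := by
        rw [Set.disjoint_left]
        intro x hx hy
        exact hab ((hFsub a hx).symm.trans (hFsub b hy))
      obtain ⟨r, hr, hrd⟩ := Metric.exists_pos_forall_lt_edist
        (hFclosed a).isCompact (hFclosed b) hd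
      refine ⟨r, by exact_mod_cast hr, fun _ x hx y hy ↦ ?_⟩
      have := (hrd x hx y hy).le
      rw [edist_nndist] at this
      rw [dist_nndist]
      exact_mod_cast this
  choose e he hes using h2
  have hne : Nonempty (Fin k × Fin k) := by
    obtain ⟨x⟩ : Nonempty X := μ.nonempty_of_neZero
    exact ⟨(ξ x, ξ x)⟩
  obtain ⟨p0, hp0⟩ := Finite.exists_min e
  refine ⟨e p0, he p0, ⋃ a, F a, MeasurableSet.iUnion fun a ↦ (hFclosed a).measurableSet, ?_, ?_⟩
  · have hsub : (⋃ a, F a)ᶜ ⊆ ⋃ a, (ξ ⁻¹' {a} \ F a) := by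
      intro x hx
      simp only [Set.mem_compl_iff, Set.mem_iUnion, not_exists] at hx
      exact Set.mem_iUnion.mpr ⟨ξ x, rfl, hx _⟩
    calc μ.real (⋃ a, F a)ᶜ ≤ μ.real (⋃ a, (ξ ⁻¹' {a} \ F a)) := measureReal_mono hsub
      _ ≤ ∑ a, μ.real (ξ ⁻¹' {a} \ F a) := measureReal_iUnion_fintype_le _
      _ ≤ ∑ _a : Fin k, δ / (k + 1) := Finset.sum_le_sum fun a _ ↦
          ENNReal.toReal_le_of_le_ofReal (by positivity) (hFμ a).le
      _ ≤ δ := by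
        simp only [Finset.sum_const, Finset.card_univ, Fintype.card_fin, nsmul_eq_mul]
        rw [mul_div_assoc', div_le_iff₀ (by positivity)]
        nlinarith
  · intro x hx y hy hxy
    obtain ⟨a, ha⟩ := Set.mem_iUnion.mp hx
    obtain ⟨b, hb⟩ := Set.mem_iUnion.mp hy
    have hxa : ξ x = a := hFsub a ha
    have hyb : ξ y = b := hFsub b hb
    rw [hxa, hyb]
    by_contra hab
    exact absurd hxy (not_lt.mpr ((hp0 (a, b)).trans (hes (a, b) hab x ha y hb)))

section Upper

variable {X : Type*} [PseudoMetricSpace X] [CompactSpace X] [MeasurableSpace X] [BorelSpace X]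
  {μ : Measure X} [IsProbabilityMeasure μ]
  {α : Type*} [Fintype α] [Nonempty α] [MeasurableSpace α] [MeasurableSingletonClass α]
  {T : X → X} {P : X → α}

omit [CompactSpace X] [BorelSpace X] [Nonempty α] in
-- The code allows a guess of `ξ (T^[j] x)` that is right whenever `T^[j] x ∈ K`. The `ξ`-itinerary
-- is therefore a function of the code and of a list of corrections. By invariance each correction
-- is nontrivial with probability at most that of `Kᶜ`, so it costs at most `η`.
theorem partitionEntropy_itinerary_le_of_code (hT : MeasurePreserving T μ μ) (hP : Measurable P)
    {k n N : ℕ} {ξ : X → Fin k} (hξ : Measurable ξ) {ε η : ℝ} {K : Set X} (hK : MeasurableSet K)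
    (hsep : ∀ x ∈ K, ∀ y ∈ K, dist x y < ε → ξ x = ξ y)
    (hsmall : ∀ e : X → Fin (k + 1), Measurable e → μ.real {x | e x ≠ 0} ≤ μ.real Kᶜ →
      partitionEntropy μ e ≤ η)
    {c : X → Fin N} (hc : Measurable c)
    (hcode : ∀ x y, itinerary T P n x = itinerary T P n y → c x = c y →
      ∀ j < n, dist (T^[j] x) (T^[j] y) < ε) :
    partitionEntropy μ (itinerary T ξ n) ≤
      partitionEntropy μ (itinerary T P n) + Real.log N + n * η := by
  classical
  obtain ⟨x0⟩ : Nonempty X := μ.nonempty_of_neZero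
  have hN : Nonempty (Fin N) := ⟨c x0⟩
  set C : X → (Fin n → α) × Fin N := fun x ↦ (itinerary T P n x, c x) with hC
  have hCm : Measurable C := (measurable_itinerary hT.measurable hP n).prodMk hc
  -- The guess reads `ξ` off an arbitrary point with the same code whose `j`-th iterate lies in `K`;
  -- without such a point it takes the junk value `ξ x0`.
  set g : ℕ → (Fin n → α) × Fin N → Fin k := fun j v ↦
    if h : ∃ x, T^[j] x ∈ K ∧ C x = v then ξ (T^[j] h.choose) else ξ x0 with hg
  have hgood : ∀ j < n, ∀ x, T^[j] x ∈ K → g j (C x) = ξ (T^[j] x) := by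
    intro j hj x hx
    have hex : ∃ y, T^[j] y ∈ K ∧ C y = C x := ⟨x, hx, rfl⟩
    simp only [hg, dif_pos hex]
    have hs := hex.choose_spec
    exact hsep _ hs.1 _ hx (hcode _ _ (Prod.ext_iff.mp hs.2).1 (Prod.ext_iff.mp hs.2).2 j hj)
  -- The correction is `0` when the guess is right, and otherwise the successor of the true label;
  -- `Fin.cases` decodes it below. Times `j ≥ n` get `0`, so that the entropy bound holds for every
  -- `j`.
  set e : ℕ → X → Fin (k + 1) := fun j x ↦
    if j < n ∧ g j (C x) ≠ ξ (T^[j] x) then (ξ (T^[j] x)).succ else 0 with he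
  have hem : ∀ j, Measurable (e j) := by
    intro j
    have h1 : Measurable fun x ↦ (g j (C x), ξ (T^[j] x)) :=
      ((measurable_of_finite (g j)).comp hCm).prodMk (hξ.comp (hT.measurable.iterate j))
    exact (measurable_of_finite (fun p : Fin k × Fin k ↦
      if j < n ∧ p.1 ≠ p.2 then p.2.succ else 0)).comp h1
  have heμ : ∀ j, partitionEntropy μ (e j) ≤ η := by
    intro j
    refine hsmall _ (hem j) ?_
    have hsub : {x | e j x ≠ 0} ⊆ T^[j] ⁻¹' Kᶜ := by
      intro x hx hxK
      apply hx
      simp only [he]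
      rw [if_neg]
      rintro ⟨hj, hne⟩
      exact hne (hgood j hj x hxK)
    refine (measureReal_mono hsub).trans_eq ?_
    exact (hT.iterate j).measureReal_preimage hK.compl.nullMeasurableSet
  have hpi : Measurable fun x (j : Fin n) ↦ e j x := measurable_pi_lambda _ fun j ↦ hem j
  have h1 := partitionEntropy_comp_le (μ := μ) (hCm.prodMk hpi)
    (fun p : ((Fin n → α) × Fin N) × (Fin n → Fin (k + 1)) ↦
      (fun j : Fin n ↦ (Fin.cases (g j p.1) id (p.2 j) : Fin k)))
  have h2 : (fun p : ((Fin n → α) × Fin N) × (Fin n → Fin (k + 1)) ↦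
      (fun j : Fin n ↦ (Fin.cases (g j p.1) id (p.2 j) : Fin k))) ∘ (fun x ↦ (C x, fun j : Fin n ↦ e j x)) =
      itinerary T ξ n := by
    funext x j
    simp only [Function.comp, he, j.2, true_and, itinerary]
    split_ifs with h
    · simp
    · simpa using h
  rw [h2] at h1
  have h3 := partitionEntropy_prod_le (μ := μ) hCm hpi
  have h4 := partitionEntropy_prod_le (μ := μ) (measurable_itinerary hT.measurable hP n) hc
  have h5 := partitionEntropy_le_log_card (μ := μ) hc
  rw [Fintype.card_fin] at h5
  have h6 := partitionEntropy_pi_le (μ := μ) hem n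
  have h7 : ∑ j ∈ Finset.range n, partitionEntropy μ (e j) ≤ n * η := by
    refine (Finset.sum_le_sum fun j _ ↦ heμ j).trans_eq ?_
    simp
  linarith

/-- For any `b` above the right-hand side, the correction cost is taken to be the slack `b - h`. The
code size and the remainder term vanish after division by `n`. -/
theorem entropyOfPartition_le_of_hasSubexponentialCode (hT : MeasurePreserving T μ μ)
    (hP : Measurable P) (hcode : HasSubexponentialCode T P) {k : ℕ} {ξ : X → Fin k}
    (hξ : Measurable ξ) {m : ℕ} (hm : 0 < m) :
    entropyOfPartition T μ ξ ≤ ((partitionEntropy μ (itinerary T P m) / m : ℝ) : EReal) := by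
  refine EReal.le_of_forall_lt_iff_le.mp fun b hb ↦ ?_
  rw [EReal.coe_lt_coe_iff] at hb
  set h := partitionEntropy μ (itinerary T P m) / m
  obtain ⟨δ, hδ, hsmall⟩ := exists_partitionEntropy_fin_succ_le k (sub_pos.mpr hb)
  obtain ⟨ε, hε, K, hK, hKδ, hsep⟩ := exists_separated_closed_fibers μ hξ hδ
  obtain ⟨N, hN, hc⟩ := hcode ε hε
  have hlim : Tendsto (fun n : ℕ ↦ ((h + m * Real.log (Fintype.card α) / n
      + Real.log (N n) / n + (b - h) : ℝ) : EReal)) atTop (nhds ((b : ℝ) : EReal)) := by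
    refine (continuous_coe_real_ereal.tendsto _).comp ?_
    have h1 : Tendsto (fun n : ℕ ↦ m * Real.log (Fintype.card α) / (n : ℝ)) atTop (nhds 0) :=
      tendsto_const_nhds.div_atTop tendsto_natCast_atTop_atTop
    simpa using ((h1.const_add h).add hN).add_const (b - h)
  rw [← hlim.limsup_eq]
  refine limsup_le_limsup ?_
  filter_upwards [eventually_ge_atTop 1] with n hn
  have hn' : (0 : ℝ) < n := by exact_mod_cast hn
  rw [EReal.coe_le_coe_iff]
  obtain ⟨c, hcm, hcc⟩ := hc n
  have h1 := partitionEntropy_itinerary_le_of_code hT hP hξ hK hsep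
    (fun e he hle ↦ hsmall μ e he (hle.trans hKδ)) hcm hcc
  have h2 := partitionEntropy_itinerary_div_le hT hP hm hn
  calc partitionEntropy μ (itinerary T ξ n) / n
      ≤ (partitionEntropy μ (itinerary T P n) + Real.log (N n) + n * (b - h)) / n := by gcongr
    _ = partitionEntropy μ (itinerary T P n) / n + Real.log (N n) / n + (b - h) := by
        field_simp
    _ ≤ _ := by gcongr

theorem measureEntropy_le_of_hasSubexponentialCode (hT : MeasurePreserving T μ μ)
    (hP : Measurable P) (hcode : HasSubexponentialCode T P) {m : ℕ} (hm : 0 < m) :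
    measureEntropy T μ ≤ ((partitionEntropy μ (itinerary T P m) / m : ℝ) : EReal) :=
  iSup_le fun _ ↦ iSup₂_le fun _ hξ ↦
    entropyOfPartition_le_of_hasSubexponentialCode hT hP hcode hξ hm

end Upper

/-! ### The planar map and its affine regimes -/

/-- First coordinate of the planar map. -/
noncomputable def stepX (x y : ℝ) : ℝ :=
  min 1 (min (6 * min x y) (max (5 * y - 9 * min x y) (y - min x y)))

/-- Second coordinate of the planar map. -/
noncomputable def stepY (x y : ℝ) : ℝ :=
  min 1 (max (y / 2) (min (2 * y) (5 * y - 9 * min x y)))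

section Planar

variable {x y : ℝ}

theorem stepX_of_le (hx : 0 ≤ x) (hy : 0 ≤ y) (hy1 : y ≤ 1) (h : y ≤ 2 * x) :
    stepX x y = y - min x y := by
  have h1 : 0 ≤ min x y := le_min hx hy
  have h2 : min x y ≤ y := min_le_right _ _
  have h3 : y ≤ 2 * min x y := by
    rcases min_choice x y with e | e <;> rw [e] <;> linarith
  unfold stepX
  rw [max_eq_right (by linarith), min_eq_right (a := 6 * _) (by linarith),
    min_eq_right (by linarith)]

theorem stepY_of_le (hy : 0 ≤ y) (hy1 : y ≤ 1) (h : y ≤ 2 * x) : stepY x y = y / 2 := by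
  have h3 : y ≤ 2 * min x y := by
    rcases min_choice x y with e | e <;> rw [e] <;> linarith
  unfold stepY
  rw [max_eq_left ((min_le_right _ _).trans (by linarith)), min_eq_right (by linarith)]

theorem stepX_of_six_mul_le (h1 : 6 * min x y ≤ 1) (h2 : 6 * min x y ≤ 2 * y) :
    stepX x y = 6 * min x y := by
  unfold stepX
  rw [min_eq_left (a := 6 * min x y) (le_max_of_le_left (by linarith)), min_eq_right h1]

theorem stepY_of_six_mul_le (hy : 0 ≤ y) (h2 : 6 * min x y ≤ 2 * y) : stepY x y = min 1 (2 * y) := by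
  unfold stepY
  rw [min_eq_left (a := 2 * y) (by linarith), max_eq_right (by linarith)]

theorem stepY_of_gap (hy : 0 ≤ y) (h : 2 * min x y < y) :
    stepY x y = min 1 (min (2 * y) (5 * y - 9 * min x y)) := by
  unfold stepY
  rw [max_eq_right (le_min (by linarith) (by linarith))]

/-- With `m = min x y`, the interpolating term `5 y - 9 m` equals `2 y` at `m = y / 3` and `y / 2`
at `m = y / 2`. It joins the doubling and halving regimes continuously, and in between it makes the
two coordinates of the image equal (compare `stepY_of_gap`). -/
theorem stepX_of_gap (h : 2 * min x y < y)
    (hg : 1 ≤ 6 * min x y ∨ 2 * y ≤ 6 * min x y) :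
    stepX x y = min 1 (min (2 * y) (5 * y - 9 * min x y)) := by
  unfold stepX
  set m := min x y
  rw [max_eq_left (by linarith)]
  rcases le_or_gt (2 * y) (6 * m) with h6 | h6
  · rw [min_eq_right (a := 6 * m) (by linarith), min_eq_right (a := 2 * y) (by linarith)]
  · have h1 : 1 ≤ 6 * m := hg.resolve_right (not_le.mpr h6)
    rw [min_eq_left (a := 1) (le_min h1 (by linarith)),
      min_eq_left (a := 1) (le_min (by linarith) (by linarith))]

theorem stepX_nonneg (hx : 0 ≤ x) (hy : 0 ≤ y) : 0 ≤ stepX x y :=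
  le_min zero_le_one (le_min (by have := le_min hx hy; linarith)
    (le_max_of_le_right (by have := min_le_right x y; linarith)))

theorem stepY_nonneg (hy : 0 ≤ y) : 0 ≤ stepY x y :=
  le_min zero_le_one (le_max_of_le_left (by linarith))

theorem stepX_le_one : stepX x y ≤ 1 := min_le_left _ _

theorem stepY_le_one : stepY x y ≤ 1 := min_le_left _ _

theorem stepY_le_two_mul (hy : 0 ≤ y) : stepY x y ≤ 2 * y :=
  (min_le_right _ _).trans (max_le (by linarith) (min_le_left _ _))

theorem stepY_pos (hy : 0 < y) : 0 < stepY x y :=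
  lt_min zero_lt_one (lt_max_of_lt_left (by linarith))

theorem stepX_le_stepY (hx : 0 ≤ x) (hy : 0 ≤ y) (hy1 : y ≤ 1) : stepX x y ≤ stepY x y := by
  have hm : min x y ≤ y := min_le_right _ _
  rcases le_or_gt y (2 * min x y) with h | h
  · have h' : y ≤ 2 * x := h.trans (by have := min_le_left x y; linarith)
    rw [stepX_of_le hx hy hy1 h', stepY_of_le hy hy1 h']
    linarith
  · by_cases hg : 1 ≤ 6 * min x y ∨ 2 * y ≤ 6 * min x y
    · rw [stepX_of_gap h hg, stepY_of_gap hy h]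
    · push Not at hg
      rw [stepX_of_six_mul_le hg.1.le hg.2.le, stepY_of_six_mul_le hy hg.2.le]
      exact le_min hg.1.le hg.2.le

theorem continuous_stepX : Continuous fun p : ℝ × ℝ ↦ stepX p.1 p.2 := by
  unfold stepX; fun_prop

theorem continuous_stepY : Continuous fun p : ℝ × ℝ ↦ stepY p.1 p.2 := by
  unfold stepY; fun_prop

end Planar

/-! ### The map on the cube: product structure, continuity, piecewise affinity -/

section Cube

variable {d : ℕ} (hd : 2 ≤ d)

/-- The first coordinate of a point of the cube. -/
noncomputable def cubeX (p : Cube d) : ℝ := p.1 (Fin.castLE hd 0)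

/-- The second coordinate of a point of the cube. -/
noncomputable def cubeY (p : Cube d) : ℝ := p.1 (Fin.castLE hd 1)

theorem cubeX_nonneg (p : Cube d) : 0 ≤ cubeX hd p := p.2.1 _
theorem cubeX_le_one (p : Cube d) : cubeX hd p ≤ 1 := p.2.2 _
theorem cubeY_nonneg (p : Cube d) : 0 ≤ cubeY hd p := p.2.1 _
theorem cubeY_le_one (p : Cube d) : cubeY hd p ≤ 1 := p.2.2 _

theorem continuous_cubeX : Continuous (cubeX hd) :=
  (continuous_apply _).comp continuous_subtype_val
theorem continuous_cubeY : Continuous (cubeY hd) :=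
  (continuous_apply _).comp continuous_subtype_val

/-- The map of the `d`-dimensional cube: the planar map times the identity. -/
noncomputable def cubeMap (p : Cube d) : Cube d :=
  ⟨fun i ↦ if (i : ℕ) = 0 then stepX (cubeX hd p) (cubeY hd p)
    else if (i : ℕ) = 1 then stepY (cubeX hd p) (cubeY hd p) else p.1 i, by
    intro i
    dsimp only
    split_ifs
    · exact stepX_nonneg (cubeX_nonneg hd p) (cubeY_nonneg hd p)
    · exact stepY_nonneg (cubeY_nonneg hd p)
    · exact p.2.1 i, by
    intro i
    dsimp only
    split_ifs
    · exact stepX_le_one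
    · exact stepY_le_one
    · exact p.2.2 i⟩

theorem cubeX_cubeMap (p : Cube d) :
    cubeX hd (cubeMap hd p) = stepX (cubeX hd p) (cubeY hd p) := by
  simp [cubeX, cubeMap]

theorem cubeY_cubeMap (p : Cube d) :
    cubeY hd (cubeMap hd p) = stepY (cubeX hd p) (cubeY hd p) := by
  simp [cubeY, cubeMap]

theorem cubeMap_apply_of_two_le (p : Cube d) {i : Fin d} (hi : 2 ≤ (i : ℕ)) :
    (cubeMap hd p).1 i = p.1 i := by
  simp only [cubeMap]
  rw [if_neg (by omega), if_neg (by omega)]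

theorem continuous_cubeMap : Continuous (cubeMap hd) := by
  refine Continuous.subtype_mk (continuous_pi fun i ↦ ?_) _
  have h : Continuous fun p : Cube d ↦ (cubeX hd p, cubeY hd p) :=
    (continuous_cubeX hd).prodMk (continuous_cubeY hd)
  split_ifs
  · exact continuous_stepX.comp h
  · exact continuous_stepY.comp h
  · exact (continuous_apply i).comp continuous_subtype_val

theorem isProductWithId_cubeMap : IsProductWithId hd (cubeMap le_rfl) (cubeMap hd) := by
  refine fun p ↦ ⟨?_, fun i hi ↦ cubeMap_apply_of_two_le hd p hi⟩
  have hX : cubeX le_rfl (planarPart hd p) = cubeX hd p := rfl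
  have hY : cubeY le_rfl (planarPart hd p) = cubeY hd p := rfl
  ext i
  change (if (i : ℕ) = 0 then _ else if (i : ℕ) = 1 then _ else _) =
    if (i : ℕ) = 0 then _ else if (i : ℕ) = 1 then _ else _
  rw [hX, hY]
  rfl

/-- A real function on the cube is piecewise affine if it is affine on each level set of a map to
a finite type. -/
def IsPiecewiseAffineFun (g : Cube d → ℝ) : Prop :=
  ∃ (α : Type) (_ : Finite α) (c : Cube d → α), ∀ a, ∃ ℓ : (Fin d → ℝ) →ᵃ[ℝ] ℝ,
    ∀ p, c p = a → g p = ℓ p.1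

theorem IsPiecewiseAffineFun.of_affine (ℓ : (Fin d → ℝ) →ᵃ[ℝ] ℝ) :
    IsPiecewiseAffineFun fun p : Cube d ↦ ℓ p.1 :=
  ⟨Unit, inferInstance, fun _ ↦ (), fun _ ↦ ⟨ℓ, fun _ _ ↦ rfl⟩⟩

theorem IsPiecewiseAffineFun.coord (i : Fin d) :
    IsPiecewiseAffineFun fun p : Cube d ↦ p.1 i :=
  of_affine (LinearMap.proj i : (Fin d → ℝ) →ₗ[ℝ] ℝ).toAffineMap

theorem IsPiecewiseAffineFun.const (r : ℝ) : IsPiecewiseAffineFun fun _ : Cube d ↦ r :=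
  of_affine (AffineMap.const ℝ _ r)

theorem IsPiecewiseAffineFun.sub {g h : Cube d → ℝ} (hg : IsPiecewiseAffineFun g)
    (hh : IsPiecewiseAffineFun h) : IsPiecewiseAffineFun fun p ↦ g p - h p := by
  obtain ⟨α, _, c, hc⟩ := hg
  obtain ⟨β, _, e, he⟩ := hh
  refine ⟨α × β, inferInstance, fun p ↦ (c p, e p), fun ab ↦ ?_⟩
  obtain ⟨ℓ, hℓ⟩ := hc ab.1
  obtain ⟨k, hk⟩ := he ab.2
  refine ⟨ℓ - k, fun p hp ↦ ?_⟩
  subst hp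
  simp [hℓ p rfl, hk p rfl]

theorem IsPiecewiseAffineFun.const_mul {g : Cube d → ℝ} (hg : IsPiecewiseAffineFun g) (r : ℝ) :
    IsPiecewiseAffineFun fun p ↦ r * g p := by
  obtain ⟨α, _, c, hc⟩ := hg
  refine ⟨α, inferInstance, c, fun a ↦ ?_⟩
  obtain ⟨ℓ, hℓ⟩ := hc a
  exact ⟨r • ℓ, fun p hp ↦ by simp [hℓ p hp]⟩

theorem IsPiecewiseAffineFun.ite {g h : Cube d → ℝ} (hg : IsPiecewiseAffineFun g)
    (hh : IsPiecewiseAffineFun h) (q : Cube d → Prop) [DecidablePred q] :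
    IsPiecewiseAffineFun fun p ↦ if q p then g p else h p := by
  obtain ⟨α, _, c, hc⟩ := hg
  obtain ⟨β, _, e, he⟩ := hh
  refine ⟨α × β × Bool, inferInstance, fun p ↦ (c p, e p, decide (q p)), fun ab ↦ ?_⟩
  obtain ⟨ℓ, hℓ⟩ := hc ab.1
  obtain ⟨k, hk⟩ := he ab.2.1
  refine ⟨if ab.2.2 then ℓ else k, fun p hp ↦ ?_⟩
  subst hp
  by_cases hq : q p
  · simp [hq, hℓ p rfl]
  · simp [hq, hk p rfl]

theorem IsPiecewiseAffineFun.min {g h : Cube d → ℝ} (hg : IsPiecewiseAffineFun g)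
    (hh : IsPiecewiseAffineFun h) : IsPiecewiseAffineFun fun p ↦ min (g p) (h p) := by
  simp only [min_def]
  exact hg.ite hh _

theorem IsPiecewiseAffineFun.max {g h : Cube d → ℝ} (hg : IsPiecewiseAffineFun g)
    (hh : IsPiecewiseAffineFun h) : IsPiecewiseAffineFun fun p ↦ max (g p) (h p) := by
  simp only [max_def]
  exact hh.ite hg _

theorem isPiecewiseAffine_of_coord {T : Cube d → Cube d}
    (h : ∀ i, IsPiecewiseAffineFun fun p ↦ (T p).1 i) : IsPiecewiseAffine T := by
  choose α hα c hc using h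
  refine ⟨(Setoid.ker fun p i ↦ c i p).classes, Setoid.finite_classes_ker _,
    Setoid.isPartition_classes _, ?_⟩
  rintro A ⟨q, rfl⟩
  choose ℓ hℓ using fun i ↦ hc i (c i q)
  refine ⟨AffineMap.pi ℓ, fun p hp ↦ ?_⟩
  have hp' : (fun i ↦ c i p) = fun i ↦ c i q := hp
  funext i
  exact hℓ i p (congrFun hp' i)

theorem isPiecewiseAffine_cubeMap : IsPiecewiseAffine (cubeMap hd) := by
  have hx : IsPiecewiseAffineFun (cubeX hd) := .coord _
  have hy : IsPiecewiseAffineFun (cubeY hd) := .coord _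
  have hm := hx.min hy
  have h5 := (hy.const_mul 5).sub (hm.const_mul 9)
  refine isPiecewiseAffine_of_coord fun i ↦ ?_
  simp only [cubeMap]
  split_ifs
  · exact (IsPiecewiseAffineFun.const 1).min ((hm.const_mul 6).min (h5.max (hy.sub hm)))
  · have h2 : IsPiecewiseAffineFun fun p ↦ cubeY hd p / 2 := by
      simpa only [div_eq_inv_mul] using hy.const_mul 2⁻¹
    exact (IsPiecewiseAffineFun.const 1).min (h2.max ((hy.const_mul 2).min h5))
  · exact .coord i

end Cube

/-! ### Comparison of two orbits with the same symbols -/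

/-- The region in which the planar map collapses to the diagonal. -/
def InGap (x y : ℝ) : Prop := 2 * min x y < y ∧ (1 ≤ 6 * min x y ∨ 2 * y ≤ 6 * min x y)

/-- The slope of a point, measured after retraction to the sector above the diagonal. -/
noncomputable def slope (x y : ℝ) : ℝ := min x y / y

/-- The ratio of two nonnegative numbers is at most `r`. -/
def RatioLE (r a b : ℝ) : Prop := a ≤ r * b ∧ b ≤ r * a

/-- A planar orbit in the unit square. -/
structure IsOrbit (x y : ℕ → ℝ) : Prop where
  x_nonneg : ∀ j, 0 ≤ x j
  y_nonneg : ∀ j, 0 ≤ y j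
  x_le : ∀ j, x j ≤ 1
  y_le : ∀ j, y j ≤ 1
  x_succ : ∀ j, x (j + 1) = stepX (x j) (y j)
  y_succ : ∀ j, y (j + 1) = stepY (x j) (y j)

section OneStep

variable {r ρ a b x y x' y' : ℝ}

theorem RatioLE.abs_sub_le (h : RatioLE (1 + r) a b) (hr : 0 ≤ r) (ha1 : a ≤ 1) (hb1 : b ≤ 1) :
    |a - b| ≤ r := by
  obtain ⟨h1, h2⟩ := h
  rw [abs_le]
  constructor <;> nlinarith

theorem RatioLE.half (h : RatioLE r a b) : RatioLE r (a / 2) (b / 2) :=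
  ⟨by linarith [h.1], by linarith [h.2]⟩

theorem RatioLE.min_one (h : RatioLE r a b) (hr : 1 ≤ r) : RatioLE r (min 1 a) (min 1 b) := by
  constructor
  · rw [mul_min_of_nonneg _ _ (by linarith)]
    exact min_le_min (by linarith) h.1
  · rw [mul_min_of_nonneg _ _ (by linarith)]
    exact min_le_min (by linarith) h.2

theorem RatioLE.two_mul (h : RatioLE r a b) : RatioLE r (2 * a) (2 * b) :=
  ⟨by linarith [h.1], by linarith [h.2]⟩

theorem not_inGap_cases (hg : ¬InGap x y) :
    y ≤ 2 * x ∨ (¬y ≤ 2 * x ∧ 6 * min x y < 1 ∧ 6 * min x y < 2 * y) := by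
  by_cases h : y ≤ 2 * x
  · exact Or.inl h
  · refine Or.inr ⟨h, ?_⟩
    have h2 : 2 * min x y < y := by
      have := min_le_left x y
      push Not at h
      linarith
    by_contra hc
    refine hg ⟨h2, ?_⟩
    by_contra hc2
    push Not at hc2
    exact hc hc2

theorem slope_nonneg (hx : 0 ≤ x) (hy : 0 ≤ y) : 0 ≤ slope x y :=
  div_nonneg (le_min hx hy) hy

theorem slope_le_one (hy : 0 ≤ y) : slope x y ≤ 1 :=
  div_le_one_of_le₀ (min_le_right _ _) hy

/-- Equal symbols outside the gap mean that both second coordinates are halved, or both doubled and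
capped at `1`; neither operation worsens a ratio bound `r ≥ 1`. -/
theorem ratioLE_stepY (hr : 1 ≤ r) (hy : 0 ≤ y) (hy1 : y ≤ 1) (hy' : 0 ≤ y') (hy1' : y' ≤ 1)
    (hg : ¬InGap x y) (hg' : ¬InGap x' y') (hs : y ≤ 2 * x ↔ y' ≤ 2 * x')
    (h : RatioLE r y y') : RatioLE r (stepY x y) (stepY x' y') := by
  rcases not_inGap_cases hg with hc | ⟨hc, -, h2⟩
  · rw [stepY_of_le hy hy1 hc, stepY_of_le hy' hy1' (hs.mp hc)]
    exact h.half
  · obtain ⟨-, -, h2'⟩ := (not_inGap_cases hg').resolve_left fun h ↦ hc (hs.mpr h)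
    rw [stepY_of_six_mul_le hy h2.le, stepY_of_six_mul_le hy' h2'.le]
    exact h.two_mul.min_one hr

theorem slope_step_of_le (hx : 0 ≤ x) (hy : 0 < y) (hy1 : y ≤ 1) (hc : y ≤ 2 * x) :
    slope (stepX x y) (stepY x y) = 2 * (1 - slope x y) := by
  have h1 := stepX_le_stepY hx hy.le hy1
  unfold slope
  rw [min_eq_left h1, stepX_of_le hx hy.le hy1 hc, stepY_of_le hy.le hy1 hc]
  field_simp

/-- The inverse form of the doubling branch. The factor `min 1 (2 y) / (6 y)` is at most `1/3`, so
slopes contract backwards in time. -/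
theorem slope_eq_of_lt (hy : 0 < y) (h1 : 6 * min x y < 1) (h2 : 6 * min x y < 2 * y) :
    slope x y = slope (stepX x y) (stepY x y) * (min 1 (2 * y) / (6 * y)) := by
  have hm : 0 < min 1 (2 * y) := lt_min one_pos (by linarith)
  unfold slope
  rw [stepX_of_six_mul_le h1.le h2.le, stepY_of_six_mul_le hy.le h2.le, min_eq_left (lt_min h1 h2).le]
  field_simp

theorem abs_scale_sub_le (hρ : 0 ≤ ρ) (hy : 0 < y) (hy' : 0 < y') (h : RatioLE (1 + ρ) y y') :
    |min 1 (2 * y) / (6 * y) - min 1 (2 * y') / (6 * y')| ≤ ρ / 3 := by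
  have key : ∀ {u v : ℝ}, 0 < u → 0 < v → u ≤ (1 + ρ) * v →
      min 1 (2 * v) / (6 * v) - min 1 (2 * u) / (6 * u) ≤ ρ / 3 := by
    intro u v hu hv huv
    have h1 : min 1 (2 * v) / (6 * v) ≤ (1 + ρ) * (min 1 (2 * u) / (6 * u)) := by
      rw [← mul_div_assoc, div_le_div_iff₀ (by positivity) (by positivity)]
      have e1 : min 1 (2 * v) * (6 * u) = min (6 * u) (12 * (u * v)) := by
        rw [min_mul_of_nonneg _ _ (by positivity)]; congr 1 <;> ring
      have e2 : (1 + ρ) * min 1 (2 * u) * (6 * v)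
          = min ((1 + ρ) * (6 * v)) ((1 + ρ) * (12 * (u * v))) := by
        rw [mul_assoc, min_mul_of_nonneg _ _ (by positivity), mul_min_of_nonneg _ _ (by positivity)]
        congr 1 <;> ring
      rw [e1, e2]
      refine min_le_min (by linarith) ?_
      have : 0 ≤ u * v := by positivity
      nlinarith
    have h2 : min 1 (2 * u) / (6 * u) ≤ 1 / 3 := by
      rw [div_le_iff₀ (by positivity)]
      have := min_le_right 1 (2 * u)
      linarith
    nlinarith
  rw [abs_le]
  exact ⟨by linarith [key hy hy' h.1], by linarith [key hy' hy h.2]⟩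

/-- Going back in time, the halving branch halves the slope error. The doubling branch contracts it
to `ρ / 3` and adds at most `ρ / 3`, since the contraction factor depends on `y`. The bound `ρ` is
thus reproduced. -/
theorem abs_slope_sub_le_of_step (hρ : 0 ≤ ρ) (hx : 0 ≤ x) (hy : 0 < y) (hy1 : y ≤ 1)
    (hx' : 0 ≤ x') (hy' : 0 < y') (hy1' : y' ≤ 1)
    (hg : ¬InGap x y) (hg' : ¬InGap x' y') (hs : y ≤ 2 * x ↔ y' ≤ 2 * x')
    (h : RatioLE (1 + ρ) y y')
    (hstep : |slope (stepX x y) (stepY x y) - slope (stepX x' y') (stepY x' y')| ≤ ρ) :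
    |slope x y - slope x' y'| ≤ ρ := by
  rcases not_inGap_cases hg with hc | ⟨hc, h1, h2⟩
  · rw [slope_step_of_le hx hy hy1 hc, slope_step_of_le hx' hy' hy1' (hs.mp hc), abs_le] at hstep
    rw [abs_le]
    constructor <;> linarith [hstep.1, hstep.2]
  · obtain ⟨-, h1', h2'⟩ := (not_inGap_cases hg').resolve_left fun h ↦ hc (hs.mpr h)
    rw [slope_eq_of_lt hy h1 h2, slope_eq_of_lt hy' h1' h2']
    have hk := abs_scale_sub_le hρ hy hy' h
    have ht0 : 0 ≤ slope (stepX x' y') (stepY x' y') :=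
      slope_nonneg (stepX_nonneg hx' hy'.le) (stepY_nonneg hy'.le)
    have ht1 : slope (stepX x' y') (stepY x' y') ≤ 1 := slope_le_one (stepY_nonneg hy'.le)
    set t := slope (stepX x y) (stepY x y)
    set t' := slope (stepX x' y') (stepY x' y')
    set κ := min 1 (2 * y) / (6 * y) with hκ
    set κ' := min 1 (2 * y') / (6 * y')
    have hκ0 : 0 ≤ κ := div_nonneg (le_min zero_le_one (by linarith)) (by linarith)
    have hκ1 : κ ≤ 1 / 3 := by
      rw [hκ, div_le_iff₀ (by positivity)]
      have := min_le_right 1 (2 * y)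
      linarith
    have e : t * κ - t' * κ' = (t - t') * κ + t' * (κ - κ') := by ring
    rw [e]
    refine (abs_add_le _ _).trans ?_
    rw [abs_mul, abs_mul, abs_of_nonneg hκ0, abs_of_nonneg ht0]
    have := abs_nonneg (t - t')
    have := abs_nonneg (κ - κ')
    nlinarith

/-- In the gap slopes are below `1/2`, so `5 - 9 t > 1/2`, and an error `9 ρ` in it is a relative
error of at most `18 ρ`. Combined with the ratio bound, `(1 + ρ) (1 + 18 ρ) ≤ 1 + 37 ρ` because `ρ ≤
1`. -/
theorem ratioLE_gap (hρ : 0 ≤ ρ) (hρ1 : ρ ≤ 1) (hy : 0 < y) (hy' : 0 < y')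
    (hg : InGap x y) (hg' : InGap x' y') (h : RatioLE (1 + ρ) y y')
    (hs : |slope x y - slope x' y'| ≤ ρ) :
    RatioLE (1 + 37 * ρ) (stepY x y) (stepY x' y') := by
  rw [stepY_of_gap hy.le hg.1, stepY_of_gap hy'.le hg'.1]
  refine RatioLE.min_one ?_ (by linarith)
  have key : ∀ {u v m k : ℝ}, 0 < u → 0 < v → u ≤ (1 + ρ) * v → 2 * k < v →
      k / v - m / u ≤ ρ →
      min (2 * u) (5 * u - 9 * m) ≤ (1 + 37 * ρ) * min (2 * v) (5 * v - 9 * k) := by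
    intro u v m k hu hv huv hk hmk
    rw [mul_min_of_nonneg _ _ (by positivity)]
    refine min_le_min (by nlinarith) ?_
    have e1 : 5 * u - 9 * m = u * (5 - 9 * (m / u)) := by field_simp
    have e2 : 5 * v - 9 * k = v * (5 - 9 * (k / v)) := by field_simp
    have hk2 : k / v < 1 / 2 := by rw [div_lt_iff₀ hv]; linarith
    rw [e1, e2]
    set p := m / u
    set q := k / v
    have h1 : 5 - 9 * p ≤ (1 + 18 * ρ) * (5 - 9 * q) := by nlinarith
    have h2 : 0 ≤ (1 + 18 * ρ) * (5 - 9 * q) := by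
      have : 0 ≤ 5 - 9 * q := by linarith
      positivity
    calc u * (5 - 9 * p) ≤ u * ((1 + 18 * ρ) * (5 - 9 * q)) := by gcongr
      _ ≤ ((1 + ρ) * v) * ((1 + 18 * ρ) * (5 - 9 * q)) := by gcongr
      _ = ((1 + ρ) * (1 + 18 * ρ)) * (v * (5 - 9 * q)) := by ring
      _ ≤ (1 + 37 * ρ) * (v * (5 - 9 * q)) := by
        have : 0 ≤ v * (5 - 9 * q) := mul_nonneg hv.le (by linarith)
        gcongr
        nlinarith
  rw [abs_le] at hs
  unfold slope at hs
  exact ⟨key hy hy' h.1 hg'.1 (by linarith [hs.1]), key hy' hy h.2 hg.1 (by linarith [hs.2])⟩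

theorem stepX_eq_stepY_of_gap (hy : 0 ≤ y) (hg : InGap x y) : stepX x y = stepY x y := by
  rw [stepX_of_gap hg.1 hg.2, stepY_of_gap hy hg.1]

theorem stepX_zero (hy : 0 ≤ y) : stepX 0 y = 0 := by
  rcases hy.eq_or_lt with rfl | hy
  · simp [stepX]
  · rw [stepX_of_six_mul_le] <;> rw [min_eq_left hy.le] <;> linarith

theorem stepY_zero (hy : 0 ≤ y) : stepY 0 y = min 1 (2 * y) := by
  rcases hy.eq_or_lt with rfl | hy
  · simp [stepY]
  · rw [stepY_of_six_mul_le hy.le]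
    rw [min_eq_left hy.le]; linarith

end OneStep

namespace IsOrbit

variable {x y x' y' : ℕ → ℝ} {ρ : ℝ}

theorem y_pos (h : IsOrbit x y) (h0 : 0 < y 0) (j : ℕ) : 0 < y j := by
  induction j with
  | zero => exact h0
  | succ j ih => rw [h.y_succ]; exact stepY_pos ih

theorem x_le_y (h : IsOrbit x y) {j : ℕ} (hj : 1 ≤ j) : x j ≤ y j := by
  obtain ⟨i, rfl⟩ := Nat.exists_eq_add_of_le' hj
  rw [h.x_succ, h.y_succ]
  exact stepX_le_stepY (h.x_nonneg i) (h.y_nonneg i) (h.y_le i)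

theorem y_le_two_pow (h : IsOrbit x y) (j : ℕ) : y j ≤ 2 ^ j * y 0 := by
  induction j with
  | zero => simp
  | succ j ih =>
    rw [h.y_succ, pow_succ]
    linarith [stepY_le_two_mul (x := x j) (h.y_nonneg j)]

/-- The gap lands on the diagonal, the diagonal on the line `x = 0`, and that line is invariant. -/
theorem after_gap (h : IsOrbit x y) {τ : ℕ} (hg : InGap (x τ) (y τ)) (i : ℕ) :
    x (τ + 2 + i) = 0 := by
  induction i with
  | zero =>
    have e : x (τ + 1) = y (τ + 1) := by
      rw [h.x_succ, h.y_succ, stepX_eq_stepY_of_gap (h.y_nonneg τ) hg]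
    rw [add_zero, h.x_succ, stepX_of_le (h.x_nonneg _) (h.y_nonneg _) (h.y_le _)
      (by rw [e]; linarith [h.y_nonneg (τ + 1)]), e]
    simp
  | succ i ih =>
    rw [← add_assoc, h.x_succ, ih]
    exact stepX_zero (h.y_nonneg _)

/-- After the gap the second coordinate is halved once and from then on doubled with cap `1`, in
both orbits alike, so the ratio bound persists and no more symbols are needed. -/
theorem ratioLE_after_gap (h : IsOrbit x y) (h' : IsOrbit x' y') (hρ : 0 ≤ ρ) (hρ1 : ρ ≤ 1)
    (h0 : 0 < y 0) (h0' : 0 < y' 0)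
    {τ : ℕ} (hg : InGap (x τ) (y τ)) (hg' : InGap (x' τ) (y' τ))
    (hr : RatioLE (1 + ρ) (y τ) (y' τ))
    (hs : |slope (x τ) (y τ) - slope (x' τ) (y' τ)| ≤ ρ) (i : ℕ) :
    RatioLE (1 + 37 * ρ) (y (τ + 1 + i)) (y' (τ + 1 + i)) := by
  induction i with
  | zero =>
    rw [add_zero, h.y_succ, h'.y_succ]
    exact ratioLE_gap hρ hρ1 (h.y_pos h0 τ) (h'.y_pos h0' τ) hg hg' hr hs
  | succ i ih =>
    rw [← add_assoc, h.y_succ, h'.y_succ]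
    rcases i with _ | i
    · have e : x (τ + 1) = y (τ + 1) := by
        rw [h.x_succ, h.y_succ, stepX_eq_stepY_of_gap (h.y_nonneg τ) hg]
      have e' : x' (τ + 1) = y' (τ + 1) := by
        rw [h'.x_succ, h'.y_succ, stepX_eq_stepY_of_gap (h'.y_nonneg τ) hg']
      rw [add_zero, stepY_of_le (h.y_nonneg _) (h.y_le _)
        (by rw [e]; linarith [h.y_nonneg (τ + 1)]),
        stepY_of_le (h'.y_nonneg _) (h'.y_le _) (by rw [e']; linarith [h'.y_nonneg (τ + 1)])]
      exact ih.half
    · have e := h.after_gap hg i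
      have e' := h'.after_gap hg' i
      rw [show τ + 2 + i = τ + 1 + (i + 1) by ring] at e e'
      rw [e, e', stepY_zero (h.y_nonneg _), stepY_zero (h'.y_nonneg _)]
      exact ih.two_mul.min_one (by linarith)

/-- Up to the gap time `τ`, ratios propagate forwards from time `0` and slopes backwards from `τ`;
together they control both coordinates. After `τ` the orbits are controlled by the ratio alone. Time
`0` is excluded because the initial point need not lie in the triangle `x ≤ y`. -/
theorem close (h : IsOrbit x y) (h' : IsOrbit x' y') (hρ : 0 ≤ ρ) (hρ1 : ρ ≤ 1)
    (h0 : 0 < y 0) (h0' : 0 < y' 0) (hr : RatioLE (1 + ρ) (y 0) (y' 0)) {n τ : ℕ}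
    (hsym : ∀ j < n, (y j ≤ 2 * x j ↔ y' j ≤ 2 * x' j)) (hτn : τ ≤ n)
    (hlt : ∀ j < τ, ¬InGap (x j) (y j)) (hlt' : ∀ j < τ, ¬InGap (x' j) (y' j))
    (hg : τ < n → InGap (x τ) (y τ)) (hg' : τ < n → InGap (x' τ) (y' τ))
    (hs : |slope (x τ) (y τ) - slope (x' τ) (y' τ)| ≤ ρ) {j : ℕ} (hj : 1 ≤ j) (hjn : j < n) :
    |x j - x' j| ≤ 37 * ρ ∧ |y j - y' j| ≤ 37 * ρ := by
  have hratio : ∀ i ≤ τ, RatioLE (1 + ρ) (y i) (y' i) := by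
    intro i
    induction i with
    | zero => exact fun _ ↦ hr
    | succ i ih =>
      intro hi
      rw [h.y_succ, h'.y_succ]
      exact ratioLE_stepY (by linarith) (h.y_nonneg i) (h.y_le i) (h'.y_nonneg i) (h'.y_le i)
        (hlt i (by omega)) (hlt' i (by omega)) (hsym i (by omega)) (ih (by omega))
  have hslope : ∀ i ≤ τ, |slope (x (τ - i)) (y (τ - i)) - slope (x' (τ - i)) (y' (τ - i))| ≤ ρ := by
    intro i
    induction i with
    | zero => exact fun _ ↦ hs
    | succ i ih =>
      intro hi
      have hih := ih (by omega)
      obtain ⟨k, hk⟩ : ∃ k, τ = k + (i + 1) := ⟨τ - (i + 1), by omega⟩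
      rw [show τ - i = k + 1 by omega, h.x_succ, h.y_succ, h'.x_succ, h'.y_succ] at hih
      rw [show τ - (i + 1) = k by omega]
      exact abs_slope_sub_le_of_step hρ (h.x_nonneg k) (h.y_pos h0 k) (h.y_le k)
        (h'.x_nonneg k) (h'.y_pos h0' k) (h'.y_le k) (hlt k (by omega)) (hlt' k (by omega))
        (hsym k (by omega)) (hratio k (by omega)) hih
  rcases le_or_gt j τ with hjτ | hjτ
  · have hrj := hratio j hjτ
    have hsj := hslope (τ - j) (by omega)
    rw [show τ - (τ - j) = j by omega] at hsj
    have hy := hrj.abs_sub_le hρ (h.y_le j) (h'.y_le j)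
    have hyp := h.y_pos h0 j
    have hyp' := h'.y_pos h0' j
    have e : x j = slope (x j) (y j) * y j := by
      unfold slope; rw [min_eq_left (h.x_le_y hj)]; field_simp
    have e' : x' j = slope (x' j) (y' j) * y' j := by
      unfold slope; rw [min_eq_left (h'.x_le_y hj)]; field_simp
    refine ⟨?_, by linarith⟩
    have ht0 := slope_nonneg (h'.x_nonneg j) (h'.y_nonneg j)
    have ht1 := slope_le_one (x := x' j) (h'.y_nonneg j)
    have e2 : x j - x' j = (slope (x j) (y j) - slope (x' j) (y' j)) * y j
        + slope (x' j) (y' j) * (y j - y' j) := by linarith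
    rw [e2]
    refine (abs_add_le _ _).trans ?_
    rw [abs_mul, abs_mul, abs_of_nonneg hyp.le, abs_of_nonneg ht0]
    have := abs_nonneg (slope (x j) (y j) - slope (x' j) (y' j))
    have := abs_nonneg (y j - y' j)
    have := h.y_le j
    nlinarith
  · have hgτ := hg (hjτ.trans hjn)
    have hgτ' := hg' (hjτ.trans hjn)
    obtain ⟨i, rfl⟩ := Nat.exists_eq_add_of_le (Nat.succ_le_of_lt hjτ)
    have hy := (h.ratioLE_after_gap h' hρ hρ1 h0 h0' hgτ hgτ' (hratio τ le_rfl) hs i).abs_sub_le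
      (by positivity) (h.y_le _) (h'.y_le _)
    refine ⟨?_, hy⟩
    rcases i with _ | i
    · simp only [Nat.succ_eq_add_one, add_zero] at hy ⊢
      rw [h.x_succ, h'.x_succ, stepX_eq_stepY_of_gap (h.y_nonneg τ) hgτ,
        stepX_eq_stepY_of_gap (h'.y_nonneg τ) hgτ', ← h.y_succ, ← h'.y_succ]
      exact hy
    · have e := h.after_gap hgτ i
      have e' := h'.after_gap hgτ' i
      rw [show τ + 2 + i = τ.succ + (i + 1) by simp only [Nat.succ_eq_add_one]; ring] at e e'
      rw [e, e']
      simpa using hρ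

end IsOrbit

/-! ### Quantization of the extra data -/

theorem tendsto_log_div_of_le_sq {N : ℕ → ℕ} {C : ℕ} (hN : ∀ n, 0 < N n)
    (hC : ∀ n, N n ≤ C * (n + 1) ^ 2) :
    Tendsto (fun n : ℕ ↦ Real.log (N n) / n) atTop (nhds 0) := by
  have h1 : Tendsto (fun n : ℕ ↦ Real.log C / (n : ℝ)) atTop (nhds 0) :=
    tendsto_const_nhds.div_atTop tendsto_natCast_atTop_atTop
  have h2 : Tendsto (fun n : ℕ ↦ Real.log ((n : ℝ) + 1) / (n : ℝ)) atTop (nhds 0) := by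
    have h := (Real.tendsto_pow_log_div_mul_add_atTop 1 (-1) 1 one_ne_zero).comp
      (tendsto_atTop_add_const_right atTop 1 tendsto_natCast_atTop_atTop)
    refine h.congr fun n ↦ ?_
    simp
  have h3 := h1.add (h2.const_mul 2)
  simp only [mul_zero, add_zero] at h3
  refine squeeze_zero (fun n ↦ by have := Real.log_natCast_nonneg (N n); positivity)
    (fun n ↦ ?_) h3
  have hCpos : 0 < C := by
    by_contra h
    have := (hN 0).trans_le (hC 0)
    simp [Nat.eq_zero_of_not_pos h] at this
  have h4 : Real.log (N n) ≤ Real.log C + 2 * Real.log ((n : ℝ) + 1) := by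
    have : (N n : ℝ) ≤ C * ((n : ℝ) + 1) ^ 2 := by exact_mod_cast hC n
    refine (Real.log_le_log (by exact_mod_cast hN n) this).trans_eq ?_
    rw [Real.log_mul (by positivity) (by positivity), Real.log_pow]
    norm_num
  calc Real.log (N n) / n ≤ (Real.log C + 2 * Real.log ((n : ℝ) + 1)) / n := by gcongr
    _ = _ := by ring

theorem abs_sub_lt_of_floor_eq {K : ℕ} (hK : 0 < K) {a b : ℝ} (ha : 0 ≤ a) (hb : 0 ≤ b)
    (h : ⌊K * a⌋₊ = ⌊K * b⌋₊) : |a - b| < 1 / K := by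
  have hK' : (0 : ℝ) < K := by exact_mod_cast hK
  have h1 := Nat.floor_le (a := K * a) (by positivity)
  have h2 := Nat.lt_floor_add_one ((K : ℝ) * a)
  have h3 := Nat.floor_le (a := K * b) (by positivity)
  have h4 := Nat.lt_floor_add_one ((K : ℝ) * b)
  rw [h] at h1 h2
  rw [abs_lt, lt_div_iff₀ hK', ← neg_div, div_lt_iff₀ hK']
  constructor <;> nlinarith

theorem floor_mul_le {K : ℕ} {a : ℝ} (ha : a ≤ 1) : ⌊K * a⌋₊ ≤ K := by
  have : (K : ℝ) * a ≤ K := by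
    have : (0 : ℝ) ≤ K := by positivity
    nlinarith
  exact (Nat.floor_le_floor this).trans_eq (Nat.floor_natCast K)

theorem eq_of_ofNat_eq {k v w : ℕ} (hv : v ≤ k) (hw : w ≤ k)
    (h : Fin.ofNat (k + 1) v = Fin.ofNat (k + 1) w) : v = w := by
  have := congrArg Fin.val h
  simpa [Fin.ofNat, Nat.mod_eq_of_lt (Nat.lt_succ_of_le hv),
    Nat.mod_eq_of_lt (Nat.lt_succ_of_le hw)] using this

open Classical in
/-- The index of the multiplicative scale `r ^ (-q)`, at most `M`, of a number in `[0, 1]`. -/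
noncomputable def scaleIndex (r : ℝ) (M : ℕ) (y : ℝ) : ℕ :=
  Nat.findGreatest (fun q ↦ y * r ^ q ≤ 1) M

theorem scaleIndex_le (r : ℝ) (M : ℕ) (y : ℝ) : scaleIndex r M y ≤ M :=
  Nat.findGreatest_le _

theorem mul_pow_scaleIndex_le (r : ℝ) (M : ℕ) {y : ℝ} (hy : y ≤ 1) :
    y * r ^ scaleIndex r M y ≤ 1 := by
  classical
  have h := Nat.findGreatest_spec (P := fun q ↦ y * r ^ q ≤ 1) (Nat.zero_le M) (by simpa using hy)
  unfold scaleIndex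
  convert h

theorem one_lt_mul_pow_scaleIndex {r : ℝ} {M : ℕ} {y : ℝ} (h : scaleIndex r M y < M) :
    1 < y * r ^ (scaleIndex r M y + 1) := by
  classical
  have h' := Nat.findGreatest_is_greatest (P := fun q ↦ y * r ^ q ≤ 1) (n := M)
    (k := scaleIndex r M y + 1) (by unfold scaleIndex; convert Nat.lt_succ_self _)
    (Nat.succ_le_of_lt h)
  exact not_le.mp h'

/-- Below the last index `M`, both numbers lie in the same interval `(r ^ (-q - 1), r ^ (-q)]`. The
last index is excluded since it also collects everything near `0`. -/
theorem ratioLE_of_scaleIndex_eq {r : ℝ} (hr : 1 ≤ r) {M : ℕ} {y y' : ℝ} (hy1 : y ≤ 1)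
    (hy1' : y' ≤ 1) (h : scaleIndex r M y = scaleIndex r M y') (hM : scaleIndex r M y < M) :
    0 < y ∧ 0 < y' ∧ RatioLE r y y' := by
  have h1 := mul_pow_scaleIndex_le r M hy1
  have h2 := one_lt_mul_pow_scaleIndex hM
  have h3 := mul_pow_scaleIndex_le r M hy1'
  have h4 := one_lt_mul_pow_scaleIndex (h ▸ hM : scaleIndex r M y' < M)
  rw [← h] at h3 h4
  have hp : 0 < r ^ scaleIndex r M y := by positivity
  rw [pow_succ] at h2 h4
  have hy : 0 < y := by
    by_contra hc
    push Not at hc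
    have : y * (r ^ scaleIndex r M y * r) ≤ 0 := mul_nonpos_of_nonpos_of_nonneg hc (by positivity)
    linarith
  have hy' : 0 < y' := by
    by_contra hc
    push Not at hc
    have : y' * (r ^ scaleIndex r M y * r) ≤ 0 := mul_nonpos_of_nonpos_of_nonneg hc (by positivity)
    linarith
  refine ⟨hy, hy', ?_, ?_⟩
  · refine le_of_mul_le_mul_right ?_ hp
    nlinarith
  · refine le_of_mul_le_mul_right ?_ hp
    nlinarith

theorem measurable_scaleIndex (r : ℝ) (M : ℕ) : Measurable (scaleIndex r M) := by
  classical
  unfold scaleIndex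
  refine measurable_findGreatest fun q _ ↦ ?_
  exact measurableSet_le (measurable_id.mul_const _) measurable_const

/-! ### The subexponential code of the cube map -/

section CubeCode

variable {d : ℕ} (hd : 2 ≤ d)

theorem isOrbit_cubeMap (p : Cube d) :
    IsOrbit (fun j ↦ cubeX hd ((cubeMap hd)^[j] p)) (fun j ↦ cubeY hd ((cubeMap hd)^[j] p)) where
  x_nonneg _ := cubeX_nonneg hd _
  y_nonneg _ := cubeY_nonneg hd _
  x_le _ := cubeX_le_one hd _
  y_le _ := cubeY_le_one hd _
  x_succ j := by rw [Function.iterate_succ_apply', cubeX_cubeMap]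
  y_succ j := by rw [Function.iterate_succ_apply', cubeY_cubeMap]

theorem iterate_cubeMap_apply_of_two_le (p : Cube d) (j : ℕ) {i : Fin d} (hi : 2 ≤ (i : ℕ)) :
    ((cubeMap hd)^[j] p).1 i = p.1 i := by
  induction j with
  | zero => rfl
  | succ j ih => rw [Function.iterate_succ_apply', cubeMap_apply_of_two_le hd _ hi, ih]

/-- The symbol of a point: `true` in the right half of the sector, where the second coordinate is
halved. -/
noncomputable def symbol (p : Cube d) : Bool := decide (cubeY hd p ≤ 2 * cubeX hd p)

theorem measurable_cubeX : Measurable (cubeX hd) := (continuous_cubeX hd).measurable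
theorem measurable_cubeY : Measurable (cubeY hd) := (continuous_cubeY hd).measurable
theorem measurable_cubeMap : Measurable (cubeMap hd) := (continuous_cubeMap hd).measurable

theorem measurable_symbol : Measurable (symbol hd) := by
  refine measurable_to_bool ?_
  have : symbol hd ⁻¹' {true} = {p | cubeY hd p ≤ 2 * cubeX hd p} := by
    ext p; simp [symbol]
  rw [this]
  exact measurableSet_le (measurable_cubeY hd) ((measurable_cubeX hd).const_mul 2)

theorem measurableSet_inGap : MeasurableSet {p : Cube d | InGap (cubeX hd p) (cubeY hd p)} := by
  have hx := measurable_cubeX hd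
  have hy := measurable_cubeY hd
  have hm := hx.min hy
  unfold InGap
  exact (measurableSet_lt (hm.const_mul 2) hy).inter
    ((measurableSet_le measurable_const (hm.const_mul 6)).union
      (measurableSet_le (hy.const_mul 2) (hm.const_mul 6)))

open Classical in
/-- The first time before `n` at which the orbit is in the gap, or `n` if there is none. -/
noncomputable def gapTime (n : ℕ) (p : Cube d) : ℕ :=
  Nat.findGreatest
    (fun q ↦ ∀ j < q, ¬InGap (cubeX hd ((cubeMap hd)^[j] p)) (cubeY hd ((cubeMap hd)^[j] p))) n

theorem gapTime_le (n : ℕ) (p : Cube d) : gapTime hd n p ≤ n := by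
  classical
  unfold gapTime
  convert Nat.findGreatest_le n

theorem not_inGap_of_lt_gapTime {n : ℕ} {p : Cube d} {j : ℕ} (hj : j < gapTime hd n p) :
    ¬InGap (cubeX hd ((cubeMap hd)^[j] p)) (cubeY hd ((cubeMap hd)^[j] p)) := by
  classical
  have h := Nat.findGreatest_spec (P := fun q ↦ ∀ j < q,
    ¬InGap (cubeX hd ((cubeMap hd)^[j] p)) (cubeY hd ((cubeMap hd)^[j] p)))
    (Nat.zero_le n) (by simp)
  refine h j ?_
  unfold gapTime at hj
  convert hj

theorem inGap_gapTime {n : ℕ} {p : Cube d} (h : gapTime hd n p < n) :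
    InGap (cubeX hd ((cubeMap hd)^[gapTime hd n p] p))
      (cubeY hd ((cubeMap hd)^[gapTime hd n p] p)) := by
  classical
  have h' := Nat.findGreatest_is_greatest (P := fun q ↦ ∀ j < q,
    ¬InGap (cubeX hd ((cubeMap hd)^[j] p)) (cubeY hd ((cubeMap hd)^[j] p))) (n := n)
    (k := gapTime hd n p + 1) (by unfold gapTime; convert Nat.lt_succ_self _)
    (Nat.succ_le_of_lt h)
  push Not at h'
  obtain ⟨j, hj, hjg⟩ := h'
  rcases (Nat.lt_succ_iff_lt_or_eq.mp hj) with hlt | rfl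
  · exact (not_inGap_of_lt_gapTime hd hlt hjg).elim
  · exact hjg

theorem measurable_gapTime (n : ℕ) : Measurable (gapTime hd n) := by
  classical
  unfold gapTime
  refine measurable_findGreatest fun q _ ↦ ?_
  have : {p | ∀ j < q, ¬InGap (cubeX hd ((cubeMap hd)^[j] p)) (cubeY hd ((cubeMap hd)^[j] p))}
      = ⋂ j ∈ Set.Iio q, (cubeMap hd)^[j] ⁻¹' {p | InGap (cubeX hd p) (cubeY hd p)}ᶜ := by
    ext p; simp
  rw [this]
  exact MeasurableSet.biInter (Set.to_countable _) fun j _ ↦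
    ((measurable_cubeMap hd).iterate j) (measurableSet_inGap hd).compl

/-- The slope at the first time in the gap. -/
noncomputable def gapSlope (n : ℕ) (p : Cube d) : ℝ :=
  slope (cubeX hd ((cubeMap hd)^[gapTime hd n p] p)) (cubeY hd ((cubeMap hd)^[gapTime hd n p] p))

theorem measurable_gapSlope (n : ℕ) : Measurable (gapSlope hd n) := by
  have h : Measurable fun q : ℕ × Cube d ↦
      slope (cubeX hd ((cubeMap hd)^[q.1] q.2)) (cubeY hd ((cubeMap hd)^[q.1] q.2)) := by
    refine measurable_from_prod_countable_right fun j ↦ ?_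
    have hx := (measurable_cubeX hd).comp ((measurable_cubeMap hd).iterate j)
    have hy := (measurable_cubeY hd).comp ((measurable_cubeMap hd).iterate j)
    exact (hx.min hy).div hy
  exact h.comp ((measurable_gapTime hd n).prodMk measurable_id)

/-- The code records the gap time, the slope at that time, the multiplicative scale of the initial
second coordinate, and all initial coordinates. Only the gap time and the scale have a range growing
with `n`, each linearly, so there are `O(n ^ 2)` values. The initial coordinates handle time `0` and
the fixed coordinates. -/
theorem hasSubexponentialCode_cubeMap : HasSubexponentialCode (cubeMap hd) (symbol hd) := by
  intro ε hε
  obtain ⟨K, hK⟩ := exists_nat_gt (max 1 (37 / ε))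
  have hK1 : (1 : ℝ) < K := (le_max_left _ _).trans_lt hK
  have hKpos : 0 < K := by
    have : (0 : ℝ) < K := by linarith
    exact_mod_cast this
  have hK' : (0 : ℝ) < K := by linarith
  set ρ : ℝ := 1 / K with hρ
  have hρ0 : 0 < ρ := by positivity
  have hρ1 : ρ ≤ 1 := by rw [hρ, div_le_one hK']; linarith
  have hρε : 37 * ρ < ε := by
    have := (le_max_right _ _).trans_lt hK
    rw [div_lt_iff₀ hε] at this
    rw [hρ, mul_one_div, div_lt_iff₀ hK']; linarith
  have hpow : 2 ≤ (1 + ρ) ^ K := by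
    have := one_add_mul_le_pow (a := ρ) (by linarith) K
    have e : (K : ℝ) * ρ = 1 := by rw [hρ]; field_simp
    linarith
  -- As `(1 + ρ) ^ K ≥ 2`, this gives `(1 + ρ) ^ M n ≥ 2 ^ n * 2 ^ K ≥ 2 ^ n * K`. A second
  -- coordinate in the last scale therefore stays below `ρ = 1 / K` during `n` doublings.
  set M : ℕ → ℕ := fun n ↦ K * n + K * K with hM
  set β : ℕ → Type := fun n ↦ Fin (n + 1) × Fin (K + 1) × Fin (M n + 1) × (Fin d → Fin (K + 1))
    with hβ
  have hcard : ∀ n, Fintype.card (β n) = (n + 1) * ((K + 1) * ((M n + 1) * (K + 1) ^ d)) := by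
    intro n; simp [hβ]
  refine ⟨fun n ↦ Fintype.card (β n), ?_, fun n ↦ ?_⟩
  · refine tendsto_log_div_of_le_sq (C := (K + 1) * ((K + K * K + 1) * (K + 1) ^ d))
      (fun n ↦ by rw [hcard]; positivity) fun n ↦ ?_
    have h1 : M n + 1 ≤ (K + K * K + 1) * (n + 1) := by simp only [hM]; nlinarith
    calc Fintype.card (β n) = (n + 1) * ((K + 1) * ((M n + 1) * (K + 1) ^ d)) := hcard n
      _ ≤ (n + 1) * ((K + 1) * (((K + K * K + 1) * (n + 1)) * (K + 1) ^ d)) := by gcongr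
      _ = _ := by ring
  set c : Cube d → β n := fun p ↦ (Fin.ofNat (n + 1) (gapTime hd n p),
    Fin.ofNat (K + 1) ⌊K * gapSlope hd n p⌋₊,
    Fin.ofNat (M n + 1) (scaleIndex (1 + ρ) (M n) (cubeY hd p)),
    fun i ↦ Fin.ofNat (K + 1) ⌊K * p.1 i⌋₊) with hc
  have hof : ∀ k, Measurable (Fin.ofNat (k + 1)) := fun k ↦ measurable_of_countable _
  have hcm : Measurable c := by
    refine Measurable.prodMk ((hof _).comp (measurable_gapTime hd n)) ?_
    refine Measurable.prodMk ((hof _).comp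
      (((measurable_gapSlope hd n).const_mul _).nat_floor)) ?_
    refine Measurable.prodMk ((hof _).comp
      ((measurable_scaleIndex _ _).comp (measurable_cubeY hd))) ?_
    refine measurable_pi_lambda _ fun i ↦ (hof _).comp ?_
    exact (((measurable_pi_apply i).comp measurable_subtype_coe).const_mul _).nat_floor
  refine ⟨Fintype.equivFin (β n) ∘ c, (measurable_of_finite _).comp hcm, ?_⟩
  intro p q hit hcpq j hj
  have hcpq := (Fintype.equivFin (β n)).injective hcpq
  have h2 := congrArg (fun b ↦ b.2.1) hcpq
  have h3 := congrArg (fun b ↦ b.2.2.1) hcpq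
  have h4 := congrArg (fun b ↦ b.2.2.2) hcpq
  have h1 := eq_of_ofNat_eq (gapTime_le hd n p) (gapTime_le hd n q) (congrArg Prod.fst hcpq)
  have hsl : ∀ p : Cube d, 0 ≤ gapSlope hd n p ∧ gapSlope hd n p ≤ 1 := fun p ↦
    ⟨slope_nonneg (cubeX_nonneg hd _) (cubeY_nonneg hd _), slope_le_one (cubeY_nonneg hd _)⟩
  have h2 := abs_sub_lt_of_floor_eq hKpos (hsl p).1 (hsl q).1
    (eq_of_ofNat_eq (floor_mul_le (hsl p).2) (floor_mul_le (hsl q).2) h2)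
  have h3 := eq_of_ofNat_eq (scaleIndex_le _ _ _) (scaleIndex_le _ _ _) h3
  have h4 : ∀ i, |p.1 i - q.1 i| < ρ := fun i ↦
    abs_sub_lt_of_floor_eq hKpos (p.2.1 i) (q.2.1 i)
      (eq_of_ofNat_eq (floor_mul_le (p.2.2 i)) (floor_mul_le (q.2.2 i)) (congrFun h4 i))
  have hP := isOrbit_cubeMap hd p
  have hQ := isOrbit_cubeMap hd q
  have hplanar : 1 ≤ j → |cubeX hd ((cubeMap hd)^[j] p) - cubeX hd ((cubeMap hd)^[j] q)| ≤ 37 * ρ ∧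
      |cubeY hd ((cubeMap hd)^[j] p) - cubeY hd ((cubeMap hd)^[j] q)| ≤ 37 * ρ := by
    intro hj1
    rcases (scaleIndex_le (1 + ρ) (M n) (cubeY hd p)).lt_or_eq with hlt | heq
    · obtain ⟨hy, hy', hr⟩ := ratioLE_of_scaleIndex_eq (by linarith) (cubeY_le_one hd p)
        (cubeY_le_one hd q) h3 hlt
      refine hP.close hQ hρ0.le hρ1 hy hy' hr (n := n) (τ := gapTime hd n p) ?_
        (gapTime_le hd n p) (fun i hi ↦ not_inGap_of_lt_gapTime hd hi)
        (fun i hi ↦ not_inGap_of_lt_gapTime hd (h1 ▸ hi)) (fun h ↦ inGap_gapTime hd h)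
        (fun h ↦ ?_) ?_ hj1 hj
      · intro i hi
        simpa [symbol] using itinerary_eq_iff.mp hit i hi
      · rw [h1] at h ⊢
        exact inGap_gapTime hd h
      · have h2 := h2.le
        unfold gapSlope at h2
        rw [← h1] at h2
        exact h2
    -- In the last scale, which contains `y = 0`, ratios carry no information; instead both planar
    -- orbits stay within `ρ` of the origin at the times considered.
    · have hsmall : ∀ u : Cube d, scaleIndex (1 + ρ) (M n) (cubeY hd u) = M n →
          0 ≤ cubeX hd ((cubeMap hd)^[j] u) ∧ cubeX hd ((cubeMap hd)^[j] u) ≤ ρ ∧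
          0 ≤ cubeY hd ((cubeMap hd)^[j] u) ∧ cubeY hd ((cubeMap hd)^[j] u) ≤ ρ := by
        intro u hu
        have hU := isOrbit_cubeMap hd u
        have e1 := mul_pow_scaleIndex_le (1 + ρ) (M n) (cubeY_le_one hd u)
        rw [hu] at e1
        have e2 : (2 : ℝ) ^ j * K ≤ (1 + ρ) ^ M n := by
          calc (2 : ℝ) ^ j * K ≤ 2 ^ n * 2 ^ K := by
                have : (K : ℝ) ≤ 2 ^ K := by exact_mod_cast Nat.lt_two_pow_self.le
                gcongr
                norm_num
            _ ≤ ((1 + ρ) ^ K) ^ n * ((1 + ρ) ^ K) ^ K := by gcongr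
            _ = _ := by simp only [hM]; rw [← pow_mul, ← pow_mul, ← pow_add]
        have e3 := hU.y_le_two_pow j
        have e0 := cubeY_nonneg hd u
        have e4 : cubeY hd u * (2 ^ j * K) ≤ 1 :=
          (mul_le_mul_of_nonneg_left e2 e0).trans e1
        have e5 : 2 ^ j * cubeY hd u ≤ ρ := by
          rw [hρ, le_div_iff₀ hK']; linarith
        have e6 : cubeY hd ((cubeMap hd)^[j] u) ≤ ρ := e3.trans e5
        exact ⟨hU.x_nonneg j, (hU.x_le_y hj1).trans e6, hU.y_nonneg j, e6⟩
      obtain ⟨a1, a2, a3, a4⟩ := hsmall p heq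
      obtain ⟨b1, b2, b3, b4⟩ := hsmall q (h3 ▸ heq)
      refine ⟨abs_le.mpr ⟨?_, ?_⟩, abs_le.mpr ⟨?_, ?_⟩⟩ <;> linarith
  rw [Subtype.dist_eq, dist_pi_lt_iff hε]
  intro i
  rw [Real.dist_eq]
  rcases Nat.eq_zero_or_pos j with rfl | hj1
  · exact (h4 i).trans (by linarith)
  · by_cases hi : 2 ≤ (i : ℕ)
    · rw [iterate_cubeMap_apply_of_two_le hd p j hi, iterate_cubeMap_apply_of_two_le hd q j hi]
      exact (h4 i).trans (by linarith)
    · have hp := hplanar hj1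
      have hi' : i = Fin.castLE hd 0 ∨ i = Fin.castLE hd 1 := by
        rcases Nat.lt_or_ge (i : ℕ) 1 with h | h
        · left; ext; simp; omega
        · right; ext; simp; omega
      rcases hi' with rfl | rfl
      · exact hp.1.trans_lt hρε
      · exact hp.2.trans_lt hρε

end CubeCode

/-! ### The reflected simple random walk -/

/-- The level reached by the walk on `ℕ` reflected at `0`, started at `0` and driven by a word:
`true` is a step up and `false` a step down. -/
def walkLevel : (n : ℕ) → (Fin n → Bool) → ℕ
  | 0, _ => 0
  | n + 1, w => if w (Fin.last n) then walkLevel n (Fin.init w) + 1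
      else walkLevel n (Fin.init w) - 1

/-- The probability that the reflected simple random walk started at `0` is at most `j` at
time `n`. -/
noncomputable def walkProb : ℕ → ℕ → ℝ
  | 0, _ => 1
  | n + 1, 0 => walkProb n 1 / 2
  | n + 1, j + 1 => (walkProb n (j + 2) + walkProb n j) / 2

theorem card_walkLevel_le (n j : ℕ) :
    ((Finset.univ.filter fun w : Fin n → Bool ↦ walkLevel n w ≤ j).card : ℝ)
      = 2 ^ n * walkProb n j := by
  induction n generalizing j with
  | zero => simp [walkLevel, walkProb]
  | succ n ih =>
    have hcard : ∀ Q : (Fin (n + 1) → Bool) → Prop, ∀ [DecidablePred Q],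
        (Finset.univ.filter Q).card =
          (Finset.univ.filter fun w : Fin n → Bool ↦ Q (Fin.snoc w true)).card +
          (Finset.univ.filter fun w : Fin n → Bool ↦ Q (Fin.snoc w false)).card := by
      intro Q _
      simp only [Finset.card_filter]
      rw [← (Fin.snocEquiv fun _ : Fin (n + 1) ↦ Bool).sum_comp, Fintype.sum_prod_type]
      simp only [Fintype.sum_bool]
      rfl
    rw [hcard]
    simp only [walkLevel, Fin.snoc_last, Fin.init_snoc, if_true, Bool.false_eq_true, if_false]
    push_cast
    rcases j with _ | j
    · have e1 : (Finset.univ.filter fun w : Fin n → Bool ↦ walkLevel n w + 1 ≤ 0).card = 0 := by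
        simp
      have e2 : (Finset.univ.filter fun w : Fin n → Bool ↦ walkLevel n w - 1 ≤ 0)
          = Finset.univ.filter fun w : Fin n → Bool ↦ walkLevel n w ≤ 1 := by
        ext w; simp only [Finset.mem_filter, Finset.mem_univ, true_and]; omega
      rw [e1, e2, ih, walkProb]
      push_cast
      ring
    · have e1 : (Finset.univ.filter fun w : Fin n → Bool ↦ walkLevel n w + 1 ≤ j + 1)
          = Finset.univ.filter fun w : Fin n → Bool ↦ walkLevel n w ≤ j := by
        ext w; simp
      have e2 : (Finset.univ.filter fun w : Fin n → Bool ↦ walkLevel n w - 1 ≤ j + 1)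
          = Finset.univ.filter fun w : Fin n → Bool ↦ walkLevel n w ≤ j + 2 := by
        ext w; simp only [Finset.mem_filter, Finset.mem_univ, true_and]; omega
      rw [e1, e2, ih, ih, walkProb]
      ring

theorem walkProb_nonneg (n j : ℕ) : 0 ≤ walkProb n j := by
  induction n generalizing j with
  | zero => simp [walkProb]
  | succ n ih =>
    rcases j with _ | j
    · rw [walkProb]; linarith [ih 1]
    · rw [walkProb]; linarith [ih (j + 2), ih j]

/-- The recursion in time preserves order and starts from the largest possible value, `1`. -/
theorem walkProb_succ_le (n j : ℕ) : walkProb (n + 1) j ≤ walkProb n j := by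
  induction n generalizing j with
  | zero => rcases j with _ | j <;> simp [walkProb]; norm_num
  | succ n ih =>
    rcases j with _ | j
    · change walkProb (n + 1) 1 / 2 ≤ walkProb n 1 / 2
      linarith [ih 1]
    · change (walkProb (n + 1) (j + 2) + walkProb (n + 1) j) / 2
        ≤ (walkProb n (j + 2) + walkProb n j) / 2
      linarith [ih (j + 2), ih j]

theorem walkProb_antitone (j : ℕ) : Antitone fun n ↦ walkProb n j :=
  antitone_nat_of_succ_le fun n ↦ walkProb_succ_le n j

/-- Null recurrence. The monotone limit `L` solves the stationary recursion, whose solutions are the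
multiples of `j + 1`; being bounded by `1`, it vanishes. -/
theorem tendsto_walkProb (j : ℕ) : Tendsto (fun n ↦ walkProb n j) atTop (nhds 0) := by
  have hbdd : ∀ j, BddBelow (Set.range fun n ↦ walkProb n j) := fun j ↦
    ⟨0, by rintro _ ⟨n, rfl⟩; exact walkProb_nonneg n j⟩
  set L : ℕ → ℝ := fun j ↦ ⨅ n, walkProb n j with hL
  have hlim : ∀ j, Tendsto (fun n ↦ walkProb n j) atTop (nhds (L j)) := fun j ↦
    tendsto_atTop_ciInf (walkProb_antitone j) (hbdd j)
  have h0 : L 0 = L 1 / 2 :=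
    tendsto_nhds_unique ((hlim 0).comp (tendsto_add_atTop_nat 1)) ((hlim 1).div_const 2)
  have hs : ∀ j, L (j + 1) = (L (j + 2) + L j) / 2 := fun j ↦
    tendsto_nhds_unique ((hlim (j + 1)).comp (tendsto_add_atTop_nat 1))
      (((hlim (j + 2)).add (hlim j)).div_const 2)
  have hlin : ∀ j : ℕ, L j = (j + 1) * L 0 ∧ L (j + 1) = (j + 2) * L 0 := by
    intro j
    induction j with
    | zero => constructor <;> push_cast <;> linarith
    | succ j ih =>
      refine ⟨by rw [ih.2]; push_cast; ring, ?_⟩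
      have := hs j
      rw [ih.1, ih.2] at this
      push_cast
      linarith
  have hle : ∀ j, L j ≤ 1 := fun j ↦ (ciInf_le (hbdd j) 0).trans (by simp [walkProb])
  have hge : ∀ j, 0 ≤ L j := fun j ↦ le_ciInf fun n ↦ walkProb_nonneg n j
  have hzero : L 0 = 0 := by
    by_contra hne
    have hpos : 0 < L 0 := lt_of_le_of_ne (hge 0) (Ne.symm hne)
    obtain ⟨k, hk⟩ := exists_nat_gt (1 / L 0)
    rw [div_lt_iff₀ hpos] at hk
    have h1 := hle k
    rw [(hlin k).1] at h1
    linarith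
  have := hlim j
  rwa [(hlin j).1, hzero, mul_zero] at this

theorem stepY_le_min {x y : ℝ} (hy : 0 ≤ y) : stepY x y ≤ min 1 (2 * y) :=
  le_min stepY_le_one (stepY_le_two_mul hy)

/-! ### No measure of maximal entropy -/

section Cube

variable {d : ℕ} (hd : 2 ≤ d)

/-- Since `y ≤ 1` initially, the walk may start at level `0`. A halving raises the level exactly,
and a doubling capped at `1` is a step down with reflection; points in the gap at most double `y`,
so they obey the same bound. -/
theorem cubeY_iterate_le (p : Cube d) (n : ℕ) :
    cubeY hd ((cubeMap hd)^[n] p) ≤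
      (1 / 2) ^ walkLevel n (itinerary (cubeMap hd) (symbol hd) n p) := by
  induction n with
  | zero => simpa [walkLevel] using cubeY_le_one hd p
  | succ n ih =>
    rw [Function.iterate_succ_apply', cubeY_cubeMap]
    have hinit : Fin.init (itinerary (cubeMap hd) (symbol hd) (n + 1) p)
        = itinerary (cubeMap hd) (symbol hd) n p := rfl
    have hlast : itinerary (cubeMap hd) (symbol hd) (n + 1) p (Fin.last n)
        = symbol hd ((cubeMap hd)^[n] p) := rfl
    rw [walkLevel, hinit, hlast]
    set q := (cubeMap hd)^[n] p
    set l := walkLevel n (itinerary (cubeMap hd) (symbol hd) n p)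
    by_cases hq : cubeY hd q ≤ 2 * cubeX hd q
    · have : symbol hd q = true := by simpa [symbol] using hq
      rw [this, if_pos rfl, stepY_of_le (cubeY_nonneg hd q) (cubeY_le_one hd q) hq, pow_succ]
      linarith
    · have : symbol hd q = false := by simpa [symbol] using hq
      rw [this, if_neg (by simp)]
      refine (stepY_le_min (cubeY_nonneg hd q)).trans ?_
      rcases l with _ | l
      · simp
      · rw [pow_succ] at ih
        refine (min_le_right _ _).trans ?_
        simp only [Nat.add_sub_cancel]
        linarith

theorem exists_partitionEntropy_itinerary_lt {μ : Measure (Cube d)} [IsProbabilityMeasure μ]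
    (hT : MeasurePreserving (cubeMap hd) μ μ) :
    ∃ m > 0, partitionEntropy μ (itinerary (cubeMap hd) (symbol hd) m) < m * Real.log 2 := by
  by_contra! hcon
  have hmeas := measurable_itinerary (measurable_cubeMap hd) (measurable_symbol hd)
  have hatom : ∀ m, 0 < m → ∀ w,
      μ.real (itinerary (cubeMap hd) (symbol hd) m ⁻¹' {w}) = ((2 : ℝ) ^ m)⁻¹ := by
    intro m hm w
    rw [measureReal_fiber_eq_of_log_card_le (hmeas m) _ w]
    · simp
    · have := hcon m hm
      simpa using this
  have hprob : ∀ n j, 0 < n → μ.real {p | walkLevel n (itinerary (cubeMap hd) (symbol hd) n p) ≤ j}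
      = walkProb n j := by
    intro n j hn
    have h1 := sum_measureReal_preimage_singleton (μ := μ)
      (f := itinerary (cubeMap hd) (symbol hd) n)
      (Finset.univ.filter fun w : Fin n → Bool ↦ walkLevel n w ≤ j)
      (fun w _ ↦ hmeas n (measurableSet_singleton w))
    rw [Finset.sum_congr rfl fun w _ ↦ hatom n hn w, Finset.sum_const, nsmul_eq_mul,
      card_walkLevel_le] at h1
    have h2 : itinerary (cubeMap hd) (symbol hd) n ⁻¹'
        ((Finset.univ.filter fun w : Fin n → Bool ↦ walkLevel n w ≤ j) : Set (Fin n → Bool))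
        = {p | walkLevel n (itinerary (cubeMap hd) (symbol hd) n p) ≤ j} := by
      ext p; simp
    rw [← h2, ← h1]
    field_simp
  have hmY : ∀ j : ℕ, MeasurableSet {p : Cube d | (1 / 2 : ℝ) ^ j ≤ cubeY hd p} := fun j ↦
    measurableSet_le measurable_const (measurable_cubeY hd)
  have hzero : ∀ j : ℕ, μ.real {p | (1 / 2 : ℝ) ^ j ≤ cubeY hd p} = 0 := by
    intro j
    -- By invariance the mass of `y ≥ 2 ^ (-j)` is the mass of the points satisfying it at time `n`,
    -- which is at most the probability that the walk is at level `≤ j` at time `n`.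
    refine le_antisymm (ge_of_tendsto (tendsto_walkProb j) ?_) measureReal_nonneg
    filter_upwards [eventually_gt_atTop 0] with n hn
    rw [← hprob n j hn, ← (hT.iterate n).measureReal_preimage (hmY j).nullMeasurableSet]
    refine measureReal_mono fun p hp ↦ ?_
    have h1 : (1 / 2 : ℝ) ^ j ≤ _ := le_trans hp (cubeY_iterate_le hd p n)
    exact (pow_le_pow_iff_right_of_lt_one₀ (by norm_num) (by norm_num)).mp h1
  have hnull : μ {p | 0 < cubeY hd p} = 0 := by
    have hsub : {p | 0 < cubeY hd p} ⊆ ⋃ j : ℕ, {p | (1 / 2 : ℝ) ^ j ≤ cubeY hd p} := by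
      intro p hp
      obtain ⟨j, hj⟩ := exists_pow_lt_of_lt_one (show 0 < cubeY hd p from hp) (by norm_num : (1 / 2 : ℝ) < 1)
      exact Set.mem_iUnion.mpr ⟨j, hj.le⟩
    refine measure_mono_null hsub (measure_iUnion_null fun j ↦ ?_)
    exact (measureReal_eq_zero_iff (measure_ne_top _ _)).mp (hzero j)
  -- The symbol `false` requires `y > 0`, now a null event, yet equidistribution gives it mass
  -- `1/2`.
  have hone : μ.real (itinerary (cubeMap hd) (symbol hd) 1 ⁻¹' {fun _ ↦ false}) = 0 := by
    rw [measureReal_eq_zero_iff (measure_ne_top _ _)]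
    refine measure_mono_null (fun p hp ↦ ?_) hnull
    have h1 := congrFun (Set.mem_singleton_iff.mp (Set.mem_preimage.mp hp)) 0
    have h2 : symbol hd p = false := h1
    simp only [symbol, decide_eq_false_iff_not, not_le] at h2
    exact (by linarith [cubeX_nonneg hd p] : 0 < cubeY hd p)
  rw [hatom 1 one_pos] at hone
  norm_num at hone

theorem measureEntropy_cubeMap_lt {μ : Measure (Cube d)}
    (hμ : μ ∈ invariantProbabilities (cubeMap hd)) :
    measureEntropy (cubeMap hd) μ < ((Real.log 2 : ℝ) : EReal) := by
  obtain ⟨_, hT⟩ := hμ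
  obtain ⟨m, hm, hlt⟩ := exists_partitionEntropy_itinerary_lt hd hT
  refine (measureEntropy_le_of_hasSubexponentialCode hT (measurable_symbol hd)
    (hasSubexponentialCode_cubeMap hd) hm).trans_lt ?_
  have hm' : (0 : ℝ) < m := by exact_mod_cast hm
  rw [EReal.coe_lt_coe_iff, div_lt_iff₀ hm']
  linarith

theorem topEntropy_cubeMap_le : topEntropy (cubeMap hd) ≤ ((Real.log 2 : ℝ) : EReal) := by
  have : Nonempty (Cube d) := ⟨⟨0, by simp⟩⟩
  have h := coverEntropy_le_of_hasSubexponentialCode (hasSubexponentialCode_cubeMap hd)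
  simpa [topEntropy] using h

end Cube

/-! ### Slopes with prescribed symbols -/

/-- The contraction factor of the inverse branch that doubles the second coordinate `2 ^ (-l)`. -/
noncomputable def branchScale (l : ℕ) : ℝ := if l = 0 then 1 / 6 else 1 / 3

/-- Next level of the walk reflected at `0`. -/
def nextLevel (b : Bool) (l : ℕ) : ℕ := if b then l + 1 else l - 1

/-- The inverse branch of the planar map, acting on slopes at level `l`. -/
noncomputable def inverseBranch (b : Bool) (l : ℕ) (t : ℝ) : ℝ :=
  if b then 1 - t / 2 else branchScale l * t

/-- Approximations of the slope of the point at level `l` whose symbols are `ω`. -/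
noncomputable def slopeApprox : ℕ → ℕ → (ℕ → Bool) → ℝ
  | 0, _, _ => 0
  | n + 1, l, ω => inverseBranch (ω 0) l (slopeApprox n (nextLevel (ω 0) l) fun k ↦ ω (k + 1))

theorem branchScale_nonneg (l : ℕ) : 0 ≤ branchScale l := by
  unfold branchScale; split_ifs <;> norm_num

theorem branchScale_le (l : ℕ) : branchScale l ≤ 1 / 3 := by
  unfold branchScale; split_ifs <;> norm_num

theorem inverseBranch_mem {b : Bool} {l : ℕ} {t : ℝ} (ht : t ∈ Set.Icc (0 : ℝ) 1) :
    inverseBranch b l t ∈ Set.Icc (0 : ℝ) 1 := by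
  have h0 := branchScale_nonneg l
  have h1 := branchScale_le l
  obtain ⟨ht0, ht1⟩ := ht
  unfold inverseBranch
  split_ifs
  · constructor <;> linarith
  · constructor <;> nlinarith

/-- The branch for `true` contracts by exactly `1/2`, the other by at most `1/3`; hence the backward
compositions converge geometrically, for every symbol sequence. -/
theorem abs_inverseBranch_sub_le (b : Bool) (l : ℕ) (t u : ℝ) :
    |inverseBranch b l t - inverseBranch b l u| ≤ |t - u| / 2 := by
  have h0 := branchScale_nonneg l
  have h1 := branchScale_le l
  unfold inverseBranch
  split_ifs
  · rw [show 1 - t / 2 - (1 - u / 2) = -((t - u) / 2) by ring, abs_neg, abs_div, abs_two]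
  · rw [← mul_sub, abs_mul, abs_of_nonneg h0]
    nlinarith [abs_nonneg (t - u)]

theorem slopeApprox_mem (n l : ℕ) (ω : ℕ → Bool) : slopeApprox n l ω ∈ Set.Icc (0 : ℝ) 1 := by
  induction n generalizing l ω with
  | zero => simp [slopeApprox]
  | succ n ih => exact inverseBranch_mem (ih _ _)

theorem dist_slopeApprox_succ_le (n l : ℕ) (ω : ℕ → Bool) :
    dist (slopeApprox n l ω) (slopeApprox (n + 1) l ω) ≤ 1 * (1 / 2) ^ n := by
  induction n generalizing l ω with
  | zero =>
    have h := slopeApprox_mem 1 l ω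
    rw [Real.dist_eq, abs_sub_comm, slopeApprox, sub_zero, abs_of_nonneg h.1]
    simpa using h.2
  | succ n ih =>
    have h := abs_inverseBranch_sub_le (ω 0) l
      (slopeApprox n (nextLevel (ω 0) l) fun k ↦ ω (k + 1))
      (slopeApprox (n + 1) (nextLevel (ω 0) l) fun k ↦ ω (k + 1))
    have h2 := ih (nextLevel (ω 0) l) fun k ↦ ω (k + 1)
    rw [Real.dist_eq] at h2 ⊢
    refine h.trans ?_
    rw [pow_succ]
    linarith

theorem exists_tendsto_slopeApprox (l : ℕ) (ω : ℕ → Bool) :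
    ∃ t, Tendsto (fun n ↦ slopeApprox n l ω) atTop (nhds t) :=
  cauchySeq_tendsto_of_complete
    (cauchySeq_of_le_geometric _ 1 (by norm_num) fun n ↦ dist_slopeApprox_succ_le n l ω)

/-- The slope of the point at level `l` whose symbols are `ω`. -/
noncomputable def codedSlope (l : ℕ) (ω : ℕ → Bool) : ℝ := (exists_tendsto_slopeApprox l ω).choose

theorem tendsto_slopeApprox (l : ℕ) (ω : ℕ → Bool) :
    Tendsto (fun n ↦ slopeApprox n l ω) atTop (nhds (codedSlope l ω)) :=
  (exists_tendsto_slopeApprox l ω).choose_spec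

theorem codedSlope_mem (l : ℕ) (ω : ℕ → Bool) : codedSlope l ω ∈ Set.Icc (0 : ℝ) 1 :=
  isClosed_Icc.mem_of_tendsto (tendsto_slopeApprox l ω)
    (Eventually.of_forall fun n ↦ slopeApprox_mem n l ω)

theorem codedSlope_eq (l : ℕ) (ω : ℕ → Bool) : codedSlope l ω =
    inverseBranch (ω 0) l (codedSlope (nextLevel (ω 0) l) fun k ↦ ω (k + 1)) := by
  have hc : Continuous (inverseBranch (ω 0) l) := by
    unfold inverseBranch; split_ifs <;> fun_prop
  exact tendsto_nhds_unique ((tendsto_slopeApprox l ω).comp (tendsto_add_atTop_nat 1))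
    ((hc.tendsto _).comp (tendsto_slopeApprox _ _))

theorem measurable_slopeApprox (n l : ℕ) : Measurable (slopeApprox n l) := by
  induction n generalizing l with
  | zero => exact measurable_const
  | succ n ih =>
    have hshift : Measurable fun (ω : ℕ → Bool) k ↦ ω (k + 1) :=
      measurable_pi_lambda _ fun k ↦ measurable_pi_apply _
    have hb : ∀ b, Measurable fun ω : ℕ → Bool ↦
        inverseBranch b l (slopeApprox n (nextLevel b l) fun k ↦ ω (k + 1)) := by
      intro b
      have hc : Continuous (inverseBranch b l) := by
        unfold inverseBranch; split_ifs <;> fun_prop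
      exact hc.measurable.comp ((ih _).comp hshift)
    have h : Measurable fun p : Bool × (ℕ → Bool) ↦
        inverseBranch p.1 l (slopeApprox n (nextLevel p.1 l) fun k ↦ p.2 (k + 1)) :=
      measurable_from_prod_countable_right hb
    have h0 : Measurable fun ω : ℕ → Bool ↦ (ω 0, ω) :=
      (measurable_pi_apply 0).prodMk measurable_id
    exact h.comp h0

theorem measurable_codedSlope (l : ℕ) : Measurable (codedSlope l) :=
  measurable_of_tendsto_metrizable (fun n ↦ measurable_slopeApprox n l)
    (tendsto_pi_nhds.mpr fun ω ↦ tendsto_slopeApprox l ω)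

/-! ### Points realizing every symbol sequence -/

section CodedPoint

variable {d : ℕ} (hd : 2 ≤ d)

/-- The point of the cube with second coordinate `2 ^ (-l)`, symbols `ω`, and vanishing last
coordinates. -/
noncomputable def codedPoint (d l : ℕ) (ω : ℕ → Bool) : Cube d :=
  ⟨fun i ↦ if (i : ℕ) = 0 then codedSlope l ω * (1 / 2) ^ l
    else if (i : ℕ) = 1 then (1 / 2) ^ l else 0, by
    intro i
    dsimp only
    split_ifs
    · exact mul_nonneg (codedSlope_mem l ω).1 (by positivity)
    · simp
    · simp, by
    intro i
    have h : (1 / 2 : ℝ) ^ l ≤ 1 := pow_le_one₀ (by norm_num) (by norm_num)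
    dsimp only
    split_ifs
    · exact mul_le_one₀ (codedSlope_mem l ω).2 (by positivity) h
    · exact h
    · simp⟩

theorem cubeX_codedPoint (l : ℕ) (ω : ℕ → Bool) :
    cubeX hd (codedPoint d l ω) = codedSlope l ω * (1 / 2) ^ l := by
  simp [cubeX, codedPoint]

theorem cubeY_codedPoint (l : ℕ) (ω : ℕ → Bool) :
    cubeY hd (codedPoint d l ω) = (1 / 2) ^ l := by
  simp [cubeY, codedPoint]

theorem codedPoint_apply_of_two_le (l : ℕ) (ω : ℕ → Bool) {i : Fin d} (hi : 2 ≤ (i : ℕ)) :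
    (codedPoint d l ω).1 i = 0 := by
  simp only [codedPoint]
  rw [if_neg (by omega), if_neg (by omega)]

theorem half_le_codedSlope {l : ℕ} {ω : ℕ → Bool} (h : ω 0 = true) : 1 / 2 ≤ codedSlope l ω := by
  rw [codedSlope_eq, h, inverseBranch, if_pos rfl]
  linarith [(codedSlope_mem (nextLevel true l) fun k ↦ ω (k + 1)).2]

theorem codedSlope_le_third {l : ℕ} {ω : ℕ → Bool} (h : ω 0 = false) :
    codedSlope l ω ≤ 1 / 3 := by
  rw [codedSlope_eq, h, inverseBranch, if_neg (by simp)]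
  have h0 := branchScale_nonneg l
  have h1 := branchScale_le l
  obtain ⟨h2, h3⟩ := codedSlope_mem (nextLevel false l) fun k ↦ ω (k + 1)
  nlinarith

theorem cube_ext {p q : Cube d} (hX : cubeX hd p = cubeX hd q) (hY : cubeY hd p = cubeY hd q)
    (h : ∀ i : Fin d, 2 ≤ (i : ℕ) → p.1 i = q.1 i) : p = q := by
  refine Subtype.ext (funext fun i ↦ ?_)
  by_cases hi : 2 ≤ (i : ℕ)
  · exact h i hi
  · have hi' : i = Fin.castLE hd 0 ∨ i = Fin.castLE hd 1 := by
      rcases Nat.lt_or_ge (i : ℕ) 1 with h | h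
      · left; ext; simp; omega
      · right; ext; simp; omega
    rcases hi' with rfl | rfl
    · exact hX
    · exact hY

theorem symbol_codedPoint (l : ℕ) (ω : ℕ → Bool) : symbol hd (codedPoint d l ω) = ω 0 := by
  have hp : (0 : ℝ) < (1 / 2) ^ l := by positivity
  unfold symbol
  rw [cubeX_codedPoint, cubeY_codedPoint]
  rcases h : ω 0 with _ | _
  · have := codedSlope_le_third (l := l) h
    rw [decide_eq_false_iff_not, not_le]
    nlinarith
  · have := half_le_codedSlope (l := l) h
    rw [decide_eq_true_eq]
    nlinarith

/-- By `codedSlope_eq` the slope is the image of the next slope under an inverse branch, and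
applying the map undoes that branch. For `false`, a next slope at most `1` means exactly `6 x ≤ min
1 (2 y)`, so the doubling formula applies. Level `0` differs because of the cap: `y = 1` stays, and
the slope is multiplied by `6` instead of `3`. -/
theorem cubeMap_codedPoint (l : ℕ) (ω : ℕ → Bool) :
    cubeMap hd (codedPoint d l ω) = codedPoint d (nextLevel (ω 0) l) fun k ↦ ω (k + 1) := by
  have hp : (0 : ℝ) < (1 / 2) ^ l := by positivity
  have hp1 : (1 / 2 : ℝ) ^ l ≤ 1 := pow_le_one₀ (by norm_num) (by norm_num)
  have hmin : min (codedSlope l ω * (1 / 2) ^ l) ((1 / 2) ^ l) = codedSlope l ω * (1 / 2) ^ l :=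
    min_eq_left (mul_le_of_le_one_left hp.le (codedSlope_mem l ω).2)
  have h0 : 0 ≤ codedSlope l ω * (1 / 2) ^ l := mul_nonneg (codedSlope_mem l ω).1 hp.le
  have hXY : stepX (codedSlope l ω * (1 / 2) ^ l) ((1 / 2) ^ l) =
        (codedSlope (nextLevel (ω 0) l) fun k ↦ ω (k + 1)) * (1 / 2) ^ nextLevel (ω 0) l ∧
      stepY (codedSlope l ω * (1 / 2) ^ l) ((1 / 2) ^ l) = (1 / 2) ^ nextLevel (ω 0) l := by
    have heq := codedSlope_eq l ω
    have hmem := codedSlope_mem (nextLevel (ω 0) l) fun k ↦ ω (k + 1)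
    set t := codedSlope (nextLevel (ω 0) l) fun k ↦ ω (k + 1)
    rcases h : ω 0 with _ | _
    · rw [h, inverseBranch, if_neg (by simp)] at heq
      have h6 : 6 * (codedSlope l ω * (1 / 2) ^ l) = t * (1 / 2) ^ nextLevel false l ∧
          min 1 (2 * (1 / 2 : ℝ) ^ l) = (1 / 2) ^ nextLevel false l := by
        rw [heq]
        rcases l with _ | l
        · simp [branchScale, nextLevel]
        · simp only [branchScale, nextLevel]
          have : (1 / 2 : ℝ) ^ l ≤ 1 := pow_le_one₀ (by norm_num) (by norm_num)
          constructor
          · simp [pow_succ]; ring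
          · rw [pow_succ, min_eq_right (by linarith)]
            simp only [Bool.false_eq_true, if_false, Nat.add_sub_cancel]
            ring
      have hle : 6 * (codedSlope l ω * (1 / 2) ^ l) ≤ min 1 (2 * (1 / 2 : ℝ) ^ l) := by
        rw [h6.1, h6.2]
        exact mul_le_of_le_one_left (by positivity) hmem.2
      have hle1 := hle.trans (min_le_left _ _)
      have hle2 := hle.trans (min_le_right _ _)
      rw [stepX_of_six_mul_le (by rw [hmin]; exact hle1) (by rw [hmin]; exact hle2),
        stepY_of_six_mul_le hp.le (by rw [hmin]; exact hle2), hmin]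
      exact h6
    · have hhalf := half_le_codedSlope (l := l) h
      rw [h, inverseBranch, if_pos rfl] at heq
      have hc : (1 / 2 : ℝ) ^ l ≤ 2 * (codedSlope l ω * (1 / 2) ^ l) := by nlinarith
      rw [stepX_of_le h0 hp.le hp1 hc, stepY_of_le hp.le hp1 hc, hmin, heq]
      simp only [nextLevel, if_true, pow_succ]
      constructor <;> ring
  refine cube_ext hd ?_ ?_ fun i hi ↦ ?_
  · rw [cubeX_cubeMap, cubeX_codedPoint, cubeY_codedPoint, cubeX_codedPoint, hXY.1]
  · rw [cubeY_cubeMap, cubeX_codedPoint, cubeY_codedPoint, cubeY_codedPoint, hXY.2]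
  · rw [cubeMap_apply_of_two_le hd _ hi, codedPoint_apply_of_two_le _ _ hi,
      codedPoint_apply_of_two_le _ _ hi]

/-- The level after `n` steps of the walk driven by `ω` and started at level `l`. -/
def levelAt (l : ℕ) (ω : ℕ → Bool) : ℕ → ℕ
  | 0 => l
  | n + 1 => nextLevel (ω n) (levelAt l ω n)

theorem iterate_cubeMap_codedPoint (l : ℕ) (ω : ℕ → Bool) (n : ℕ) :
    (cubeMap hd)^[n] (codedPoint d l ω) = codedPoint d (levelAt l ω n) fun k ↦ ω (n + k) := by
  induction n with
  | zero => simp [levelAt]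
  | succ n ih =>
    rw [Function.iterate_succ_apply', ih, cubeMap_codedPoint]
    simp only [levelAt, add_zero]
    congr 1
    funext k
    congr 1
    ring

theorem symbol_iterate_codedPoint (l : ℕ) (ω : ℕ → Bool) (n : ℕ) :
    symbol hd ((cubeMap hd)^[n] (codedPoint d l ω)) = ω n := by
  rw [iterate_cubeMap_codedPoint, symbol_codedPoint, add_zero]

theorem levelAt_congr {l : ℕ} {ω ω' : ℕ → Bool} {n : ℕ} (h : ∀ j < n, ω j = ω' j) :
    levelAt l ω n = levelAt l ω' n := by
  induction n with
  | zero => rfl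
  | succ n ih => rw [levelAt, levelAt, h n n.lt_succ_self, ih fun j hj ↦ h j (hj.trans n.lt_succ_self)]

/-- As long as the symbols agree, the levels agree. At a common level `L` different symbols mean
slopes `≥ 1/2` and `≤ 1/3`, hence first coordinates at distance at least `2 ^ (-L) / 6`. Bounded
levels make the separation uniform. -/
theorem eq_of_dist_iterate_codedPoint_lt {l M : ℕ} {ω ω' : ℕ → Bool}
    (hM : ∀ n, levelAt l ω n ≤ M) {n : ℕ}
    (h : ∀ j < n, dist ((cubeMap hd)^[j] (codedPoint d l ω))
      ((cubeMap hd)^[j] (codedPoint d l ω')) < (1 / 2) ^ M / 6) :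
    ∀ j < n, ω j = ω' j := by
  intro j
  induction j using Nat.strong_induction_on with
  | _ j ih =>
    intro hj
    have hlev := levelAt_congr (l := l) fun i hi ↦ ih i hi (hi.trans hj)
    have hd1 := h j hj
    rw [iterate_cubeMap_codedPoint, iterate_cubeMap_codedPoint, ← hlev] at hd1
    have hpow : (1 / 2 : ℝ) ^ M ≤ (1 / 2) ^ levelAt l ω j :=
      pow_le_pow_of_le_one (by norm_num) (by norm_num) (hM j)
    have hx : |cubeX hd (codedPoint d (levelAt l ω j) fun k ↦ ω (j + k)) -
        cubeX hd (codedPoint d (levelAt l ω j) fun k ↦ ω' (j + k))| <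
          (1 / 2) ^ levelAt l ω j / 6 := by
      refine (lt_of_le_of_lt ?_ hd1).trans_le (by linarith)
      exact dist_le_pi_dist (codedPoint d (levelAt l ω j) fun k ↦ ω (j + k)).1
        (codedPoint d (levelAt l ω j) fun k ↦ ω' (j + k)).1 (Fin.castLE hd 0)
    rw [cubeX_codedPoint, cubeX_codedPoint, abs_lt] at hx
    set L := levelAt l ω j
    have hp : (0 : ℝ) < (1 / 2) ^ L := by positivity
    rcases e : ω j with _ | _ <;> rcases e' : ω' j with _ | _
    · rfl
    · have h1 := codedSlope_le_third (l := L) (ω := fun k ↦ ω (j + k)) e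
      have h2 := half_le_codedSlope (l := L) (ω := fun k ↦ ω' (j + k)) e'
      exfalso
      nlinarith
    · have h1 := half_le_codedSlope (l := L) (ω := fun k ↦ ω (j + k)) e
      have h2 := codedSlope_le_third (l := L) (ω := fun k ↦ ω' (j + k)) e'
      exfalso
      nlinarith
    · rfl

theorem measurable_codedPoint (d l : ℕ) : Measurable (codedPoint d l) := by
  refine Measurable.subtype_mk (measurable_pi_lambda _ fun i ↦ ?_)
  split_ifs
  · exact (measurable_codedSlope l).mul_const _
  · exact measurable_const
  · exact measurable_const

end CodedPoint

/-! ### Balanced blocks -/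

/-- Balanced blocks: subsets with `m` elements of `{0, …, 2 m - 1}`. -/
abbrev Block (m : ℕ) : Type := ↥(Finset.powersetCard m (Finset.range (2 * m)))

theorem card_block (m : ℕ) : Fintype.card (Block m) = m.centralBinom := by
  rw [Fintype.card_coe, Finset.card_powersetCard, Finset.card_range, Nat.centralBinom]

/-- The concatenation of a sequence of blocks. -/
noncomputable def blockWord (m : ℕ) (β : ℕ → Fin (Fintype.card (Block m))) (n : ℕ) : Bool :=
  decide (n % (2 * m) ∈ ((Fintype.equivFin (Block m)).symm (β (n / (2 * m)))).1)

/-- A block has only `m` steps down and starts at level `m`, so before each of them the level is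
positive: reflection never acts, and the level is `m` plus ups minus downs. -/
theorem levelAt_block {l m a : ℕ} {ω : ℕ → Bool} {s : Finset ℕ}
    (hs : s ∈ Finset.powersetCard m (Finset.range (2 * m))) (ha : levelAt l ω a = m)
    (hω : ∀ r < 2 * m, ω (a + r) = decide (r ∈ s)) {r : ℕ} (hr : r ≤ 2 * m) :
    levelAt l ω (a + r) + (Finset.range r \ s).card = m + (Finset.range r ∩ s).card := by
  obtain ⟨hsub, hcard⟩ := Finset.mem_powersetCard.mp hs
  have hcompl : (Finset.range (2 * m) \ s).card = m := by
    rw [Finset.card_sdiff_of_subset hsub, Finset.card_range, hcard]; omega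
  induction r with
  | zero => simp [ha]
  | succ r ih =>
    have ih := ih (by omega)
    rw [← add_assoc, levelAt, hω r (by omega), Finset.range_add_one]
    by_cases h : r ∈ s
    · rw [Finset.insert_sdiff_of_mem _ h, Finset.insert_inter_of_mem h,
        Finset.card_insert_of_notMem (by simp)]
      simp only [h, decide_true, nextLevel, if_true]
      omega
    · have h1 : (insert r (Finset.range r \ s)).card ≤ m := by
        rw [← hcompl]
        refine Finset.card_le_card fun i hi ↦ ?_
        rcases Finset.mem_insert.mp hi with rfl | hi
        · exact Finset.mem_sdiff.mpr ⟨Finset.mem_range.mpr (by omega), h⟩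
        · obtain ⟨h2, h3⟩ := Finset.mem_sdiff.mp hi
          exact Finset.mem_sdiff.mpr
            ⟨Finset.mem_range.mpr ((Finset.mem_range.mp h2).trans (by omega)), h3⟩
      rw [Finset.insert_sdiff_of_notMem _ h, Finset.insert_inter_of_notMem h]
      rw [Finset.card_insert_of_notMem (by simp)] at h1 ⊢
      simp only [h, decide_false, nextLevel, Bool.false_eq_true, if_false]
      omega

section Block

variable {m : ℕ} (hm : 0 < m) (β : ℕ → Fin (Fintype.card (Block m)))

include hm

theorem blockWord_mul_add {k r : ℕ} (hr : r < 2 * m) : blockWord m β (2 * m * k + r) =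
    decide (r ∈ ((Fintype.equivFin (Block m)).symm (β k)).1) := by
  rw [blockWord, Nat.mul_add_mod, Nat.mod_eq_of_lt hr, Nat.mul_add_div (by omega),
    Nat.div_eq_of_lt hr, add_zero]

theorem levelAt_blockWord_mul (k : ℕ) : levelAt m (blockWord m β) (2 * m * k) = m := by
  induction k with
  | zero => rfl
  | succ k ih =>
    have hs := ((Fintype.equivFin (Block m)).symm (β k)).2
    have h := levelAt_block hs ih (fun r hr ↦ blockWord_mul_add hm β hr) le_rfl
    obtain ⟨hsub, hcard⟩ := Finset.mem_powersetCard.mp hs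
    rw [Finset.card_sdiff_of_subset hsub, Finset.inter_eq_right.mpr hsub, Finset.card_range,
      hcard] at h
    rw [mul_add, mul_one]
    omega

theorem levelAt_blockWord_le (n : ℕ) : levelAt m (blockWord m β) n ≤ 2 * m := by
  have hs := ((Fintype.equivFin (Block m)).symm (β (n / (2 * m)))).2
  have h := levelAt_block hs (levelAt_blockWord_mul hm β (n / (2 * m)))
    (fun r hr ↦ blockWord_mul_add hm β hr) (Nat.mod_lt n (by omega : 0 < 2 * m)).le
  rw [Nat.div_add_mod] at h
  have h2 := Finset.card_le_card
    (Finset.inter_subset_right (s₁ := Finset.range (n % (2 * m)))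
      (s₂ := ((Fintype.equivFin (Block m)).symm (β (n / (2 * m)))).1))
  rw [(Finset.mem_powersetCard.mp hs).2] at h2
  omega

theorem eq_of_blockWord_eq {β β' : ℕ → Fin (Fintype.card (Block m))} {k : ℕ}
    (h : ∀ r < 2 * m, blockWord m β (2 * m * k + r) = blockWord m β' (2 * m * k + r)) :
    β k = β' k := by
  apply (Fintype.equivFin (Block m)).symm.injective
  refine Subtype.ext (Finset.ext fun r ↦ ?_)
  have hsub := (Finset.mem_powersetCard.mp ((Fintype.equivFin (Block m)).symm (β k)).2).1
  have hsub' := (Finset.mem_powersetCard.mp ((Fintype.equivFin (Block m)).symm (β' k)).2).1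
  by_cases hr : r < 2 * m
  · have := h r hr
    rw [blockWord_mul_add hm β hr, blockWord_mul_add hm β' hr] at this
    simpa using this
  · exact ⟨fun h ↦ (hr (Finset.mem_range.mp (hsub h))).elim,
      fun h ↦ (hr (Finset.mem_range.mp (hsub' h))).elim⟩

theorem iterate_cubeMap_blockWord {d : ℕ} (hd : 2 ≤ d) :
    (cubeMap hd)^[2 * m] (codedPoint d m (blockWord m β)) =
      codedPoint d m (blockWord m fun k ↦ β (k + 1)) := by
  have h := levelAt_blockWord_mul hm β 1
  rw [mul_one] at h
  rw [iterate_cubeMap_codedPoint, h]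
  congr 1
  funext k
  rw [blockWord, blockWord, Nat.add_mod_left, Nat.add_div_left _ (by omega)]

omit hm in
theorem measurable_blockWord : Measurable (blockWord m) := by
  refine measurable_pi_lambda _ fun n ↦ ?_
  exact (measurable_of_finite fun b : Fin (Fintype.card (Block m)) ↦
    decide (n % (2 * m) ∈ ((Fintype.equivFin (Block m)).symm b).1)).comp
    (measurable_pi_apply (n / (2 * m)))

end Block

/-! ### Lower bounds from the horseshoes of balanced blocks -/

theorem tendsto_block_rate (m : ℕ) (c : ℝ) :
    Tendsto (fun n : ℕ ↦ ((c / (2 * m) - 2 * c / n : ℝ) : EReal)) atTop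
      (nhds ((c / (2 * m) : ℝ) : EReal)) := by
  refine (continuous_coe_real_ereal.tendsto _).comp ?_
  have h1 : Tendsto (fun n : ℕ ↦ 2 * c / (n : ℝ)) atTop (nhds 0) :=
    tendsto_const_nhds.div_atTop tendsto_natCast_atTop_atTop
  simpa using h1.const_sub (c / (2 * m))

/-- The loss `2 c / n` pays for at most two incomplete blocks, one at each end of a window of length
`n`. -/
theorem block_rate_le {m n K : ℕ} (hm : 0 < m) (hn : 0 < n) (hK : n / (2 * m) ≤ K + 1) {c : ℝ}
    (hc : 0 ≤ c) : c / (2 * m) - 2 * c / n ≤ K * c / n := by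
  have hm' : (0 : ℝ) < m := by exact_mod_cast hm
  have hn' : (0 : ℝ) < n := by exact_mod_cast hn
  have h1 : (n : ℝ) < 2 * m * (K + 2) := by
    have := Nat.lt_mul_div_succ n (by omega : 0 < 2 * m)
    have h2 : 2 * m * (n / (2 * m) + 1) ≤ 2 * m * (K + 2) := Nat.mul_le_mul_left _ (by omega)
    exact_mod_cast this.trans_le h2
  have h2 : (n : ℝ) / (2 * m) ≤ K + 2 := by
    rw [div_le_iff₀ (by positivity)]; linarith
  have h3 : c / (2 * m) = (n : ℝ) / (2 * m) * c / n := by field_simp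
  rw [h3, sub_le_iff_le_add, ← add_div]
  gcongr
  nlinarith

section Lower

variable {d : ℕ} (hd : 2 ≤ d) {m : ℕ} (hm : 0 < m)

theorem card_block_pos (m : ℕ) : 0 < Fintype.card (Block m) := by
  rw [card_block]; exact Nat.centralBinom_pos m

include hm in
-- Different choices of the first `n / (2 m)` blocks give orbits that separate at scale `2 ^ (-2 m)
-- / 6`. The radius is half of this, so one point of a dynamical cover cannot shadow two of them.
theorem pow_le_coverMincard (n : ℕ) :
    ((Fintype.card (Block m) ^ (n / (2 * m)) : ℕ) : ℕ∞) ≤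
      Dynamics.coverMincard (cubeMap hd) Set.univ
        {p | dist p.1 p.2 < (1 / 2) ^ (2 * m) / 12} n := by
  refine le_iInf₂ fun s hs ↦ ?_
  set K := n / (2 * m) with hK
  set c := Fintype.card (Block m)
  -- Finite block words are padded with an arbitrary fixed block.
  set ext : (Fin K → Fin c) → ℕ → Fin c := fun b k ↦
    if h : k < K then b ⟨k, h⟩ else ⟨0, card_block_pos m⟩
  have hex : ∀ b : Fin K → Fin c, ∃ q ∈ s, ∀ j < n,
      dist ((cubeMap hd)^[j] (codedPoint d m (blockWord m (ext b)))) ((cubeMap hd)^[j] q)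
        < (1 / 2) ^ (2 * m) / 12 := by
    intro b
    obtain ⟨q, hq, hqb⟩ := hs (Set.mem_univ (codedPoint d m (blockWord m (ext b))))
    exact ⟨q, hq, fun j hj ↦ Dynamics.mem_dynEntourage.mp hqb j hj⟩
  choose g hgs hg using hex
  have hinj : Function.Injective fun b ↦ (⟨g b, hgs b⟩ : s) := by
    intro b b' hbb
    have hbb : g b = g b' := congrArg Subtype.val hbb
    have hclose := eq_of_dist_iterate_codedPoint_lt hd (ω := blockWord m (ext b))
      (ω' := blockWord m (ext b')) (levelAt_blockWord_le hm (ext b)) (n := n) fun j hj ↦ by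
        have h1 := hg b j hj
        have h2 := hg b' j hj
        rw [← hbb, dist_comm] at h2
        have := dist_triangle ((cubeMap hd)^[j] (codedPoint d m (blockWord m (ext b))))
          ((cubeMap hd)^[j] (g b)) ((cubeMap hd)^[j] (codedPoint d m (blockWord m (ext b'))))
        linarith
    funext k
    have hk := eq_of_blockWord_eq hm (β := ext b) (β' := ext b') (k := k) fun r hr ↦ by
      refine hclose _ ?_
      have h1 : 2 * m * (k + 1) ≤ 2 * m * K := by gcongr; exact k.2
      have h2 : 2 * m * K ≤ n := Nat.mul_div_le n (2 * m)
      rw [mul_add, mul_one] at h1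
      omega
    simpa [ext, k.2] using hk
  have := Fintype.card_le_of_injective _ hinj
  simp only [Fintype.card_pi, Finset.prod_const, Finset.card_univ, Fintype.card_fin,
    Fintype.card_coe] at this
  exact_mod_cast this

include hm in
theorem block_rate_le_topEntropy :
    ((Real.log (Fintype.card (Block m)) / (2 * m) : ℝ) : EReal) ≤ topEntropy (cubeMap hd) := by
  have hU : {p : Cube d × Cube d | dist p.1 p.2 < (1 / 2) ^ (2 * m) / 12} ∈ uniformity (Cube d) :=
    Metric.dist_mem_uniformity (by positivity)
  refine le_trans ?_ (Dynamics.coverEntropyEntourage_le_coverEntropy _ _ hU)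
  rw [← (tendsto_block_rate m (Real.log (Fintype.card (Block m)))).limsup_eq]
  refine limsup_le_limsup ?_
  filter_upwards [eventually_ge_atTop 1] with n hn
  have hpos : 0 < Fintype.card (Block m) ^ (n / (2 * m)) := Nat.pow_pos (card_block_pos m)
  have h1 : ((Real.log ((Fintype.card (Block m) ^ (n / (2 * m)) : ℕ) : ℝ) : ℝ) : EReal) ≤
      ENNReal.log (Dynamics.coverMincard (cubeMap hd) Set.univ
        {p | dist p.1 p.2 < (1 / 2) ^ (2 * m) / 12} n : ENNReal) := by
    rw [← ennrealLog_natCast hpos]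
    refine ENNReal.log_monotone ?_
    have := ENat.toENNReal_mono (pow_le_coverMincard hd hm n)
    simpa using this
  refine le_trans ?_ (EReal.div_le_div_right_of_nonneg (by positivity) h1)
  have h2 : ((n : ℕ) : EReal) = ((n : ℝ) : EReal) := by simp
  rw [h2, ← EReal.coe_div, EReal.coe_le_coe_iff, Nat.cast_pow, Real.log_pow]
  exact block_rate_le hm hn (Nat.le_succ _) (Real.log_natCast_nonneg _)

/-- The Bernoulli measure on sequences of balanced blocks. -/
noncomputable def blockMeasure (m : ℕ) : Measure (ℕ → Fin (Fintype.card (Block m))) :=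
  Measure.infinitePi fun _ ↦ ProbabilityTheory.uniformOn Set.univ

instance isProbabilityMeasure_uniformOn_block (m : ℕ) : IsProbabilityMeasure
    (ProbabilityTheory.uniformOn (Set.univ : Set (Fin (Fintype.card (Block m))))) := by
  have : Nonempty (Fin (Fintype.card (Block m))) := ⟨⟨0, card_block_pos m⟩⟩
  exact ProbabilityTheory.isProbabilityMeasure_uniformOn Set.finite_univ Set.univ_nonempty

instance isProbabilityMeasure_blockMeasure (m : ℕ) : IsProbabilityMeasure (blockMeasure m) := by
  unfold blockMeasure; infer_instance

theorem measurePreserving_shift_blockMeasure (m : ℕ) :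
    MeasurePreserving (fun (β : ℕ → Fin (Fintype.card (Block m))) k ↦ β (k + 1))
      (blockMeasure m) (blockMeasure m) := by
  have hmeas : Measurable fun (β : ℕ → Fin (Fintype.card (Block m))) k ↦ β (k + 1) :=
    measurable_pi_lambda _ fun k ↦ measurable_pi_apply _
  refine ⟨hmeas, Measure.eq_infinitePi _ fun s t ht ↦ ?_⟩
  rw [Measure.map_apply hmeas (MeasurableSet.pi s.countable_toSet fun i _ ↦ ht i)]
  have : (fun (β : ℕ → Fin (Fintype.card (Block m))) k ↦ β (k + 1)) ⁻¹' (Set.pi s t) =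
      Set.pi (s.map (addRightEmbedding 1)) fun k ↦ t (k - 1) := by
    ext β; simp [Set.mem_pi]
  rw [this, blockMeasure, Measure.infinitePi_pi _ fun i _ ↦ ht _, Finset.prod_map]
  simp

/-- Block `0` is left free, because a window starting inside it sees only part of it. -/
theorem blockMeasure_real_eq (m K : ℕ) (b : ℕ → Fin (Fintype.card (Block m))) :
    (blockMeasure m).real {β | ∀ k < K, β (k + 1) = b (k + 1)} =
      ((Fintype.card (Block m) : ℝ) ^ K)⁻¹ := by
  have h1 : {β | ∀ k < K, β (k + 1) = b (k + 1)} =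
      Set.pi ((Finset.range K).map (addRightEmbedding 1)) fun k ↦ {b k} := by
    ext β; simp [Set.mem_pi]
  rw [h1, Measure.real, blockMeasure, Measure.infinitePi_pi _ fun i _ ↦ measurableSet_singleton _,
    Finset.prod_map]
  simp [ProbabilityTheory.uniformOn_univ]

/-- The invariant measure carried by the concatenations of balanced blocks. -/
noncomputable def horseshoeMeasure (m : ℕ) : Measure (Cube d) :=
  (2 * m : ENNReal)⁻¹ • ∑ j ∈ Finset.range (2 * m),
    (blockMeasure m).map fun β ↦ (cubeMap hd)^[j] (codedPoint d m (blockWord m β))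

theorem measurable_iterate_codedPoint_blockWord (m j : ℕ) :
    Measurable fun β ↦ (cubeMap hd)^[j] (codedPoint d m (blockWord m β)) :=
  ((measurable_cubeMap hd).iterate j).comp ((measurable_codedPoint d m).comp measurable_blockWord)

include hm in
-- Pushing forward by the map moves each summand to the next one. The last returns to the first
-- because `2 m` iterates act as the block shift, which preserves the Bernoulli measure.
theorem horseshoeMeasure_mem : horseshoeMeasure hd m ∈ invariantProbabilities (cubeMap hd) := by
  have hmeas := measurable_iterate_codedPoint_blockWord hd m
  have h2m : (2 * m : ENNReal) ≠ 0 := by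
    simp only [ne_eq, mul_eq_zero, OfNat.ofNat_ne_zero, Nat.cast_eq_zero, false_or]; omega
  have h2m' : (2 * m : ENNReal) ≠ ⊤ := ENNReal.mul_ne_top (by simp) (by simp)
  refine ⟨⟨?_⟩, measurable_cubeMap hd, ?_⟩
  · rw [horseshoeMeasure, Measure.smul_apply, Measure.finsetSum_apply]
    have h1 : ∀ j ∈ Finset.range (2 * m), (blockMeasure m).map
        (fun β ↦ (cubeMap hd)^[j] (codedPoint d m (blockWord m β))) Set.univ = 1 := fun j _ ↦ by
      rw [Measure.map_apply (hmeas j) MeasurableSet.univ, Set.preimage_univ, measure_univ]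
    rw [Finset.sum_congr rfl h1]
    simp [ENNReal.inv_mul_cancel h2m h2m']
  · rw [horseshoeMeasure, Measure.map_smul]
    congr 1
    rw [← Measure.mapₗ_apply_of_measurable (measurable_cubeMap hd), map_sum]
    have h1 : ∀ j ∈ Finset.range (2 * m), Measure.mapₗ (cubeMap hd) ((blockMeasure m).map
        fun β ↦ (cubeMap hd)^[j] (codedPoint d m (blockWord m β))) = (blockMeasure m).map
        fun β ↦ (cubeMap hd)^[j + 1] (codedPoint d m (blockWord m β)) := fun j _ ↦ by
      rw [Measure.mapₗ_apply_of_measurable (measurable_cubeMap hd),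
        Measure.map_map (measurable_cubeMap hd) (hmeas j)]
      congr 1
      funext β
      simp only [Function.comp, Function.iterate_succ_apply']
    rw [Finset.sum_congr rfl h1]
    have h2 : (blockMeasure m).map
        (fun β ↦ (cubeMap hd)^[2 * m] (codedPoint d m (blockWord m β))) =
        (blockMeasure m).map fun β ↦ (cubeMap hd)^[0] (codedPoint d m (blockWord m β)) := by
      have hshift := measurePreserving_shift_blockMeasure m
      conv_rhs => rw [← hshift.map_eq]
      rw [Measure.map_map (hmeas 0) hshift.measurable]
      congr 1
      funext β
      rw [iterate_cubeMap_blockWord hm β hd]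
      rfl
    have h3 : ∀ (f : ℕ → Measure (Cube d)) (N : ℕ), f N = f 0 →
        ∑ j ∈ Finset.range N, f (j + 1) = ∑ j ∈ Finset.range N, f j := by
      rintro f (_ | N) h
      · simp
      · rw [Finset.sum_range_succ, Finset.sum_range_succ', h]
    exact h3 (fun j ↦ (blockMeasure m).map
      fun β ↦ (cubeMap hd)^[j] (codedPoint d m (blockWord m β))) (2 * m) h2

include hm in
-- A window of `n` symbols starting at a position `j < 2 m` contains blocks `1` to `n / (2 m) - 1`
-- entirely, so it fixes them. The bound holds for each `j`, hence for the average.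
theorem horseshoeMeasure_real_le {n : ℕ} (w : Fin n → Bool) :
    (horseshoeMeasure hd m).real (itinerary (cubeMap hd) (symbol hd) n ⁻¹' {w}) ≤
      ((Fintype.card (Block m) : ℝ) ^ (n / (2 * m) - 1))⁻¹ := by
  set A := itinerary (cubeMap hd) (symbol hd) n ⁻¹' {w}
  have hA : MeasurableSet A :=
    measurable_itinerary (measurable_cubeMap hd) (measurable_symbol hd) n
      (measurableSet_singleton w)
  set K := n / (2 * m) - 1 with hK
  set q : ℝ := ((Fintype.card (Block m) : ℝ) ^ K)⁻¹ with hq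
  have hmeas := measurable_iterate_codedPoint_blockWord hd m
  have h2m : (2 * m : ENNReal) ≠ 0 := by
    simp only [ne_eq, mul_eq_zero, OfNat.ofNat_ne_zero, Nat.cast_eq_zero, false_or]; omega
  have h2m' : (2 * m : ENNReal) ≠ ⊤ := ENNReal.mul_ne_top (by simp) (by simp)
  have hone : ∀ j ∈ Finset.range (2 * m), (blockMeasure m).map
      (fun β ↦ (cubeMap hd)^[j] (codedPoint d m (blockWord m β))) A ≤ ENNReal.ofReal q := by
    intro j hj
    rw [Finset.mem_range] at hj
    rw [Measure.map_apply (hmeas j) hA]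
    set B := (fun β ↦ (cubeMap hd)^[j] (codedPoint d m (blockWord m β))) ⁻¹' A
    have hB : ∀ β ∈ B, ∀ i (hi : i < n), blockWord m β (i + j) = w ⟨i, hi⟩ := by
      intro β hβ i hi
      have h := congrFun (Set.mem_singleton_iff.mp (Set.mem_preimage.mp hβ)) ⟨i, hi⟩
      simp only [itinerary] at h
      rw [← Function.iterate_add_apply, symbol_iterate_codedPoint] at h
      exact h
    rcases B.eq_empty_or_nonempty with hBe | ⟨b, hb⟩
    · simp [hBe]
    · have hsub : B ⊆ {β | ∀ k < K, β (k + 1) = b (k + 1)} := by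
        intro β hβ k hk
        refine eq_of_blockWord_eq hm fun r hr ↦ ?_
        have h1 : 2 * m * (k + 1 + 1) ≤ 2 * m * (n / (2 * m)) := Nat.mul_le_mul_left _ (by omega)
        have h2 := Nat.mul_div_le n (2 * m)
        obtain ⟨i, hi⟩ : ∃ i, 2 * m * (k + 1) + r = i + j :=
          ⟨2 * m * (k + 1) + r - j, by rw [mul_add, mul_one]; omega⟩
        have hin : i < n := by
          rw [mul_add _ (k + 1), mul_one] at h1
          omega
        rw [hi, hB β hβ i hin, hB b hb i hin]
      refine (measure_mono hsub).trans_eq ?_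
      rw [hq, ← blockMeasure_real_eq m K b, ofReal_measureReal]
  have hle : horseshoeMeasure hd m A ≤ ENNReal.ofReal q := by
    rw [horseshoeMeasure, Measure.smul_apply, Measure.finsetSum_apply, smul_eq_mul]
    calc (2 * m : ENNReal)⁻¹ * ∑ j ∈ Finset.range (2 * m), (blockMeasure m).map
          (fun β ↦ (cubeMap hd)^[j] (codedPoint d m (blockWord m β))) A
        ≤ (2 * m : ENNReal)⁻¹ * ∑ _j ∈ Finset.range (2 * m), ENNReal.ofReal q := by
          gcongr with j hj
          exact hone j hj
      _ = ENNReal.ofReal q := by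
          rw [Finset.sum_const, Finset.card_range, nsmul_eq_mul, Nat.cast_mul, Nat.cast_two,
            ← mul_assoc, ENNReal.inv_mul_cancel h2m h2m', one_mul]
  exact ENNReal.toReal_le_of_le_ofReal (by positivity) hle

include hm in
-- All words of length `n` have uniformly small mass, so the entropy of the word partition is at
-- least minus the logarithm of that bound.
theorem block_rate_le_measureEntropy :
    ((Real.log (Fintype.card (Block m)) / (2 * m) : ℝ) : EReal) ≤
      measureEntropy (cubeMap hd) (horseshoeMeasure hd m) := by
  have := (horseshoeMeasure_mem hd hm).1
  set ξ : Cube d → Fin 2 := fun p ↦ finTwoEquiv.symm (symbol hd p) with hξ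
  have hξm : Measurable ξ := (measurable_of_finite _).comp (measurable_symbol hd)
  refine le_trans ?_ (le_iSup_of_le 2 (le_iSup₂_of_le ξ hξm le_rfl))
  rw [← (tendsto_block_rate m (Real.log (Fintype.card (Block m)))).limsup_eq]
  refine limsup_le_limsup ?_
  filter_upwards [eventually_ge_atTop 1] with n hn
  rw [EReal.coe_le_coe_iff]
  refine (block_rate_le hm hn (K := n / (2 * m) - 1) (by omega)
    (Real.log_natCast_nonneg _)).trans ?_
  gcongr
  have h1 := neg_log_le_partitionEntropy (μ := horseshoeMeasure hd m)
    (measurable_itinerary (measurable_cubeMap hd) hξm n)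
    (q := ((Fintype.card (Block m) : ℝ) ^ (n / (2 * m) - 1))⁻¹) fun w ↦ by
      have h2 : itinerary (cubeMap hd) ξ n ⁻¹' {w} =
          itinerary (cubeMap hd) (symbol hd) n ⁻¹' {fun i ↦ finTwoEquiv (w i)} := by
        ext p
        simp only [Set.mem_preimage, Set.mem_singleton_iff, funext_iff, itinerary, hξ]
        exact forall_congr' fun i ↦ Equiv.symm_apply_eq _
      rw [h2]
      exact horseshoeMeasure_real_le hd hm _
  rwa [Real.log_inv, neg_neg, Real.log_pow] at h1

theorem tendsto_block_entropy : Tendsto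
    (fun m : ℕ ↦ ((Real.log 2 - Real.log (2 * m) / (2 * m) : ℝ) : EReal)) atTop
      (nhds ((Real.log 2 : ℝ) : EReal)) := by
  refine (continuous_coe_real_ereal.tendsto _).comp ?_
  have h1 := (Real.tendsto_pow_log_div_mul_add_atTop 1 0 1 one_ne_zero).comp
    (tendsto_natCast_atTop_atTop.const_mul_atTop (zero_lt_two (α := ℝ)))
  have h2 := h1.const_sub (Real.log 2)
  rw [sub_zero] at h2
  refine h2.congr fun m ↦ ?_
  simp

/-- The central binomial coefficient is the largest in its row, up to a polynomial factor all of `2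
^ (2 m)`: here `4 ^ m ≤ 2 m * centralBinom m`. -/
theorem block_entropy_le {m : ℕ} (hm : 0 < m) :
    Real.log 2 - Real.log (2 * m) / (2 * m) ≤ Real.log (Fintype.card (Block m)) / (2 * m) := by
  have hm' : (0 : ℝ) < m := by exact_mod_cast hm
  have h1 : (4 : ℝ) ^ m ≤ 2 * m * m.centralBinom := by
    exact_mod_cast Nat.four_pow_le_two_mul_self_mul_centralBinom m hm
  have hc : (0 : ℝ) < m.centralBinom := by exact_mod_cast Nat.centralBinom_pos m
  have h2 := Real.log_le_log (by positivity) h1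
  rw [Real.log_mul (by positivity) hc.ne', Real.log_pow,
    show (4 : ℝ) = 2 ^ 2 by norm_num, Real.log_pow] at h2
  rw [card_block, sub_le_iff_le_add, ← add_div, le_div_iff₀ (by positivity)]
  push_cast at h2
  linarith

theorem log_two_le_topEntropy_cubeMap :
    ((Real.log 2 : ℝ) : EReal) ≤ topEntropy (cubeMap hd) := by
  refine le_of_tendsto tendsto_block_entropy ?_
  filter_upwards [eventually_gt_atTop 0] with m hm
  exact (EReal.coe_le_coe_iff.mpr (block_entropy_le hm)).trans (block_rate_le_topEntropy hd hm)

theorem log_two_le_supMeasureEntropy_cubeMap :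
    ((Real.log 2 : ℝ) : EReal) ≤ supMeasureEntropy (cubeMap hd) := by
  refine le_of_tendsto tendsto_block_entropy ?_
  filter_upwards [eventually_gt_atTop 0] with m hm
  exact (EReal.coe_le_coe_iff.mpr (block_entropy_le hm)).trans
    ((block_rate_le_measureEntropy hd hm).trans
      (le_iSup₂_of_le _ (horseshoeMeasure_mem hd hm) le_rfl))

end Lower

end PiecewiseAffineEntropy

theorem mainTheorem2 :
    ∃ F : PiecewiseAffineEntropy.Cube 2 → PiecewiseAffineEntropy.Cube 2,
      ∀ (d : ℕ) (hd : 2 ≤ d),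
        ∃ T : PiecewiseAffineEntropy.Cube d → PiecewiseAffineEntropy.Cube d,
          PiecewiseAffineEntropy.IsProductWithId hd F T ∧
          Continuous T ∧
          PiecewiseAffineEntropy.IsPiecewiseAffine T ∧
          PiecewiseAffineEntropy.topEntropy T = PiecewiseAffineEntropy.supMeasureEntropy T ∧
          PiecewiseAffineEntropy.supMeasureEntropy T = ((Real.log 2 : ℝ) : EReal) ∧
          ¬ ∃ μ ∈ PiecewiseAffineEntropy.invariantProbabilities T,
              PiecewiseAffineEntropy.measureEntropy T μ =
                PiecewiseAffineEntropy.supMeasureEntropy T := by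
  open PiecewiseAffineEntropy in
  refine ⟨cubeMap le_rfl, fun d hd ↦ ⟨cubeMap hd, isProductWithId_cubeMap hd,
    continuous_cubeMap hd, isPiecewiseAffine_cubeMap hd, ?_⟩⟩
  have htop : topEntropy (cubeMap hd) = ((Real.log 2 : ℝ) : EReal) :=
    le_antisymm (topEntropy_cubeMap_le hd) (log_two_le_topEntropy_cubeMap hd)
  have hsup : supMeasureEntropy (cubeMap hd) = ((Real.log 2 : ℝ) : EReal) :=
    le_antisymm (iSup₂_le fun μ hμ ↦ (measureEntropy_cubeMap_lt hd hμ).le)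
      (log_two_le_supMeasureEntropy_cubeMap hd)
  refine ⟨htop.trans hsup.symm, hsup, ?_⟩
  rintro ⟨μ, hμ, heq⟩
  exact (measureEntropy_cubeMap_lt hd hμ).ne (heq.trans hsup)
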